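/- **Setting.** For real-valued $V_0,W\in L^\infty(\mathbb R)$, $\alpha,\lambda\in\mathbb R$ and $k\in\mathbb N=\{1,2,\dots\}$ consider in $L^2(\mathbb R)$ the operators $$L_{0,\lambda}^k=-\frac{d^2}{dy^2}+k^2\bigl(1-\lambda V_0(y)-W(y)\bigr),\qquad D(L_{0,\lambda}^k)=H^2(\mathbb R),$$ $$L_\lambda^k=-\frac{d^2}{dy^2}+k^2\bigl(1-\lambda V_0(y)-W(y)-\alpha\delta_0(y)\bigr),\qquad D(L_\lambda^k)=\{\phi\in H^1(\mathbb R)\cap H^2(\mathbb R\setminus\{0\}) : \phi'(0+)-\phi'(0-)=-k^2\alpha\,\phi(0)\},$$ where $L_\lambda^k\phi=-\phi''+k^2(1-\lambda V_0-W)\phi$ on $\mathbb R\setminus\{0\}$; $\rho(L)$ is the set of $\mu\in\mathbb C$ such that $\mu-L:D(L)\to L^2(\mathbb R)$ has a bounded inverse. Let $\Gamma$ and $V(\lambda,\cdot)$, $\lambda\in\mathbb R$, be distributions on $\mathbb R$. We say that the *hypotheses of the existence theorem* for traveling waves, i.e. for solutions of $$-\Phi_{yy}-(1-V(\lambda,y))\Phi_{xx}+\Gamma(y)(\Phi^3)_{xx}=0,$$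 hold at $(k_*,\lambda_*)\in\mathbb N\times\mathbb R$ if $\Gamma=\gamma\delta_0$ and $V(\lambda,\cdot)=\lambda V_0+W+\alpha\delta_0$ for some $\gamma,\alpha\in\mathbb R$ and real-valued $V_0,W\in L^\infty(\mathbb R)$, and - $(\tilde L0)$ $V_0$ and $W$ are even; - $(\tilde L1)$ there is an interval $I\subset\mathbb R$ such that $0\in\rho(L_{0,\lambda}^k)$ for all $k\in\mathbb N$ and $\lambda\in I$; - $(\tilde L2)$ there is an open interval $I_{\lambda_*}\subset I$ containing $\lambda_*$ such that zero is an isolated point of the spectrum of $L_{\lambda_*}^{k_*}$ and an eigenvalue of it with one-dimensional eigenspace, and $0\in\rho(L_\lambda^k)$ for all $(k,\lambda)\in\mathbb N\times I_{\lambda_*}$ with $(k,\lambda)\ne(k_*,\lambda_*)$; - $(\tilde L3)$ there is $C>0$ such that for all $k\in\mathbb N$ and $\lambda\in I_{\lambda_*}$ the problem $-\phi''+k^2(1-\lambda V_0-W)\phi=0$ on $(0,\infty)$, $\phi(0)=1$, has a solution $\phi\in H^2(0,\infty)$, and every such solution satisfies $\|\phi\|_{L^2(0,\infty)}\le C$;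 - (transversality) $\int_{\mathbb R}V_0|\phi^*|^2\,dy\ne0$, where $\phi^*$ spans $\ker L_{\lambda_*}^{k_*}$. **Corollary 2.11** (Case P2, distributional $\Gamma$). Let $\gamma,\beta\in\mathbb R$, $k_*\in\mathbb N$ and $\lambda_*<1$, and let $\Gamma=\gamma\delta_0$ and $$V(\lambda,y)=\lambda\mathbf 1_{|y|\ge b}+\beta\mathbf 1_{|y|<b}+\alpha\delta_0(y),$$ where $b$ and $\alpha$ are as follows: - if $\beta>1$: $\displaystyle b=\frac{\pi}{\sqrt{\beta-1}}$ and $\displaystyle\alpha=\frac{2\sqrt{1-\lambda_*}}{k_*}$; - if $\beta<1$: $b>0$ is arbitrary and $$\alpha=\frac{2\sqrt{1-\beta}}{k_*}\cdot\frac{\sqrt{1-\beta}\,\sinh(k_*\sqrt{1-\beta}\,b)+\sqrt{1-\lambda_*}\,\cosh(k_*\sqrt{1-\beta}\,b)}{\sqrt{1-\beta}\,\cosh(k_*\sqrt{1-\beta}\,b)+\sqrt{1-\lambda_*}\,\sinh(k_*\sqrt{1-\beta}\,b)};$$ - if $\beta=1$: $b>0$ is arbitrary and $\displaystyle\alpha=\frac{2\sqrt{1-\lambda_*}}{k_*\bigl(1+\sqrt{1-\lambda_*}\,k_*b\bigr)}$.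 Then, in all three cases, $b>0$, $\alpha>0$, and the hypotheses of the existence theorem hold at $(k_*,\lambda_*)$. -/

import Mathlib

open MeasureTheory Filter Topology Set
open scoped ENNReal ContDiff Distributions

noncomputable section

namespace TravelingWave

/-! ### Weak derivatives and traces on the line -/

/-- `v` is the weak derivative of `u` on the open set `U ⊆ ℝ`:
`∫ u η' = - ∫ v η` for all test functions `η ∈ C_c^∞(U)`. It is only used for functions `u`, `v`
that are square integrable on `U`; their values outside `U` play no role. -/
def IsWeakDeriv (U : Set ℝ) (u v : ℝ → ℂ) : Prop :=
  ∀ η : ℝ → ℝ, ContDiff ℝ ∞ η → HasCompactSupport η → tsupport η ⊆ U →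
    ∫ y, deriv η y • u y = - ∫ y, η y • v y

/-- The (almost everywhere defined) function `u` has the limit `a` along the filter `l`, null sets
being disregarded. With `l = 𝓝[≠] 0` this says that `a` is the value at `0` of the representative
of `u` that is continuous there; with `l = 𝓝[>] 0` and `l = 𝓝[<] 0` it gives the one-sided
values `u(0+)` and `u(0-)`. -/
def HasTrace (l : Filter ℝ) (u : ℝ → ℂ) (a : ℂ) : Prop :=
  Tendsto u (l ⊓ ae volume) (𝓝 a)

/-- The complex Hilbert space `L²(ℝ)`. -/
abbrev L2 : Type := Lp ℂ 2 (volume : Measure ℝ)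

theorem integrable_smul_L2 (u : L2) {η : ℝ → ℝ} (hη : Continuous η) (hc : HasCompactSupport η) :
    Integrable (fun y => η y • u y) := by
  have h : LocallyIntegrable (u : ℝ → ℂ) := (Lp.memLp u).locallyIntegrable (by norm_num)
  exact h.integrable_smul_left_of_hasCompactSupport hη hc

theorem IsWeakDeriv.congr {U : Set ℝ} {u u₁ v v₁ : ℝ → ℂ} (h : IsWeakDeriv U u v)
    (hu : u =ᵐ[volume] u₁) (hv : v =ᵐ[volume] v₁) : IsWeakDeriv U u₁ v₁ := by
  intro η h1 h2 h3
  have e1 : ∫ y, deriv η y • u₁ y = ∫ y, deriv η y • u y :=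
    integral_congr_ae (by filter_upwards [hu] with y hy; rw [hy])
  have e2 : ∫ y, η y • v₁ y = ∫ y, η y • v y :=
    integral_congr_ae (by filter_upwards [hv] with y hy; rw [hy])
  rw [e1, e2]
  exact h η h1 h2 h3

theorem IsWeakDeriv.add {U : Set ℝ} {u u₁ v v₁ : L2} (h : IsWeakDeriv U u v)
    (h₁ : IsWeakDeriv U u₁ v₁) : IsWeakDeriv U (u + u₁ : L2) (v + v₁ : L2) := by
  have key : IsWeakDeriv U ((u : ℝ → ℂ) + u₁) ((v : ℝ → ℂ) + v₁) := by
    intro η d1 d2 d3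
    have c : Continuous η := d1.continuous
    have c' : Continuous (deriv η) := d1.continuous_deriv (by simp)
    simp only [Pi.add_apply, smul_add]
    rw [integral_add (integrable_smul_L2 u c' d2.deriv) (integrable_smul_L2 u₁ c' d2.deriv),
      integral_add (integrable_smul_L2 v c d2) (integrable_smul_L2 v₁ c d2),
      h η d1 d2 d3, h₁ η d1 d2 d3]
    ring
  exact key.congr (Lp.coeFn_add u u₁).symm (Lp.coeFn_add v v₁).symm

theorem IsWeakDeriv.smul {U : Set ℝ} {u v : L2} (c : ℂ) (h : IsWeakDeriv U u v) :
    IsWeakDeriv U (c • u : L2) (c • v : L2) := by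
  have key : IsWeakDeriv U (c • (u : ℝ → ℂ)) (c • (v : ℝ → ℂ)) := by
    intro η d1 d2 d3
    simp only [Pi.smul_apply, smul_comm _ c]
    rw [integral_smul, integral_smul, h η d1 d2 d3, smul_neg]
  exact key.congr (Lp.coeFn_smul c u).symm (Lp.coeFn_smul c v).symm

theorem IsWeakDeriv.zero (U : Set ℝ) : IsWeakDeriv U (0 : L2) (0 : L2) := by
  have key : IsWeakDeriv U (0 : ℝ → ℂ) (0 : ℝ → ℂ) := by intro η _ _ _; simp
  exact key.congr (Lp.coeFn_zero ℂ 2 volume).symm (Lp.coeFn_zero ℂ 2 volume).symm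

/-- Weak derivatives are unique (on `U`). -/
theorem IsWeakDeriv.ae_eq_zero {U : Set ℝ} (hU : IsOpen U) {u v : L2} (h : IsWeakDeriv U u v)
    (hu : ∀ᵐ y, y ∈ U → (u : ℝ → ℂ) y = 0) : ∀ᵐ y, y ∈ U → (v : ℝ → ℂ) y = 0 := by
  have hv : LocallyIntegrable (v : ℝ → ℂ) := (Lp.memLp v).locallyIntegrable (by norm_num)
  refine hU.ae_eq_zero_of_integral_contDiff_smul_eq_zero (hv.locallyIntegrableOn U) ?_
  intro g h1 h2 h3
  have e : ∫ y, deriv g y • u y = 0 := by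
    refine integral_eq_zero_of_ae ?_
    filter_upwards [hu] with y hy
    by_cases hyU : y ∈ U
    · simp [hy hyU]
    · have : deriv g y = 0 := by
        by_contra hne
        exact hyU (h3 (support_deriv_subset hne))
      simp [this]
  have := h g h1 h2 h3
  rw [e] at this
  simpa using this.symm

theorem HasTrace.congr {l : Filter ℝ} {u u₁ : ℝ → ℂ} {a : ℂ} (h : HasTrace l u a)
    (hu : u =ᵐ[volume] u₁) : HasTrace l u₁ a :=
  Tendsto.congr' (hu.filter_mono inf_le_right) h

theorem HasTrace.add {l : Filter ℝ} {u u₁ : L2} {a a₁ : ℂ} (h : HasTrace l u a)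
    (h₁ : HasTrace l u₁ a₁) : HasTrace l (u + u₁ : L2) (a + a₁) :=
  HasTrace.congr (u := (u : ℝ → ℂ) + u₁) (Tendsto.add h h₁) (Lp.coeFn_add u u₁).symm

theorem HasTrace.smul {l : Filter ℝ} {u : L2} {a : ℂ} (c : ℂ) (h : HasTrace l u a) :
    HasTrace l (c • u : L2) (c * a) :=
  HasTrace.congr (u := c • (u : ℝ → ℂ)) (Tendsto.const_smul h c) (Lp.coeFn_smul c u).symm

theorem HasTrace.zero (l : Filter ℝ) : HasTrace l (0 : L2) 0 :=
  HasTrace.congr (u := (0 : ℝ → ℂ)) tendsto_const_nhds (Lp.coeFn_zero ℂ 2 volume).symm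

/-! ### Schrödinger operators on `L²(ℝ)` -/

/-- The graph of `-d²/dy² + q` with domain `H²(ℝ)`: the pairs `(u, f)` with `u ∈ H²(ℝ)` and
`f = -u'' + q u ∈ L²(ℝ)`. For `q ∈ L^∞(ℝ)` the first components fill `H²(ℝ)`. -/
def regularGraph (q : ℝ → ℝ) : Submodule ℂ (L2 × L2) where
  carrier := {p | ∃ v w : L2, IsWeakDeriv univ p.1 v ∧ IsWeakDeriv univ v w ∧
    (p.2 : ℝ → ℂ) =ᵐ[volume] fun y => - w y + q y * p.1 y}
  zero_mem' := by
    refine ⟨0, 0, IsWeakDeriv.zero _, IsWeakDeriv.zero _, ?_⟩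
    filter_upwards [Lp.coeFn_zero ℂ 2 (volume : Measure ℝ)] with y hy
    simp
  add_mem' := by
    rintro ⟨u, f⟩ ⟨u₁, f₁⟩ ⟨v, w, h1, h2, h3⟩ ⟨v₁, w₁, k1, k2, k3⟩
    refine ⟨v + v₁, w + w₁, h1.add k1, h2.add k2, ?_⟩
    filter_upwards [Lp.coeFn_add f f₁, Lp.coeFn_add w w₁, Lp.coeFn_add u u₁, h3, k3]
      with y e1 e2 e3 e4 e5
    simp only [Prod.fst_add, Prod.snd_add, e1, e2, e3, Pi.add_apply] at *
    rw [e4, e5]; ring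
  smul_mem' := by
    rintro c ⟨u, f⟩ ⟨v, w, h1, h2, h3⟩
    refine ⟨c • v, c • w, h1.smul c, h2.smul c, ?_⟩
    filter_upwards [Lp.coeFn_smul c f, Lp.coeFn_smul c w, Lp.coeFn_smul c u, h3] with y e1 e2 e3 e4
    simp only [Prod.smul_fst, Prod.smul_snd, e1, e2, e3, Pi.smul_apply, smul_eq_mul] at *
    rw [e4]; ring

/-- The graph of `-d²/dy² + q - c δ₀` with domain
`{u ∈ H¹(ℝ) ∩ H²(ℝ ∖ {0}) | u'(0+) - u'(0-) = -c u(0)}`: the pairs `(u, f)` with `u` in this domain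
and `f = -u'' + q u ∈ L²(ℝ)`, the second derivative being taken on `ℝ ∖ {0}`. -/
def deltaGraph (q : ℝ → ℝ) (c : ℝ) : Submodule ℂ (L2 × L2) where
  carrier := {p | ∃ v w : L2, ∃ a r l : ℂ, IsWeakDeriv univ p.1 v ∧ IsWeakDeriv {0}ᶜ v w ∧
    HasTrace (𝓝[≠] 0) p.1 a ∧ HasTrace (𝓝[>] 0) v r ∧ HasTrace (𝓝[<] 0) v l ∧
    r - l = - c * a ∧
    (p.2 : ℝ → ℂ) =ᵐ[volume] fun y => - w y + q y * p.1 y}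
  zero_mem' := by
    refine ⟨0, 0, 0, 0, 0, IsWeakDeriv.zero _, IsWeakDeriv.zero _, HasTrace.zero _,
      HasTrace.zero _, HasTrace.zero _, by simp, ?_⟩
    filter_upwards [Lp.coeFn_zero ℂ 2 (volume : Measure ℝ)] with y hy
    simp
  add_mem' := by
    rintro ⟨u, f⟩ ⟨u₁, f₁⟩ ⟨v, w, a, r, l, h1, h2, t1, t2, t3, j, h3⟩
      ⟨v₁, w₁, a₁, r₁, l₁, k1, k2, s1, s2, s3, j₁, k3⟩
    refine ⟨v + v₁, w + w₁, a + a₁, r + r₁, l + l₁, h1.add k1, h2.add k2, t1.add s1, t2.add s2,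
      t3.add s3, by linear_combination j + j₁, ?_⟩
    filter_upwards [Lp.coeFn_add f f₁, Lp.coeFn_add w w₁, Lp.coeFn_add u u₁, h3, k3]
      with y e1 e2 e3 e4 e5
    simp only [Prod.fst_add, Prod.snd_add, e1, e2, e3, Pi.add_apply] at *
    rw [e4, e5]; ring
  smul_mem' := by
    rintro z ⟨u, f⟩ ⟨v, w, a, r, l, h1, h2, t1, t2, t3, j, h3⟩
    refine ⟨z • v, z • w, z * a, z * r, z * l, h1.smul z, h2.smul z, t1.smul z, t2.smul z,
      t3.smul z, by linear_combination z * j, ?_⟩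
    filter_upwards [Lp.coeFn_smul z f, Lp.coeFn_smul z w, Lp.coeFn_smul z u, h3] with y e1 e2 e3 e4
    simp only [Prod.smul_fst, Prod.smul_snd, e1, e2, e3, Pi.smul_apply, smul_eq_mul] at *
    rw [e4]; ring

theorem regularGraph_single_valued (q : ℝ → ℝ) (p : L2 × L2) (hp : p ∈ regularGraph q)
    (h0 : p.1 = 0) : p.2 = 0 := by
  obtain ⟨u, f⟩ := p
  obtain ⟨v, w, h1, h2, h3⟩ := hp
  simp only at h0
  subst h0
  have z := Lp.coeFn_zero ℂ 2 (volume : Measure ℝ)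
  have hv := h1.ae_eq_zero isOpen_univ (by filter_upwards [z] with y hy _; simp)
  have hw := h2.ae_eq_zero isOpen_univ hv
  apply Lp.ext
  filter_upwards [z, hw, h3] with y e1 e2 e3
  simp_all

theorem deltaGraph_single_valued (q : ℝ → ℝ) (c : ℝ) (p : L2 × L2) (hp : p ∈ deltaGraph q c)
    (h0 : p.1 = 0) : p.2 = 0 := by
  obtain ⟨u, f⟩ := p
  obtain ⟨v, w, a, r, l, h1, h2, -, -, -, -, h3⟩ := hp
  simp only at h0
  subst h0
  have z := Lp.coeFn_zero ℂ 2 (volume : Measure ℝ)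
  have hv := h1.ae_eq_zero isOpen_univ (by filter_upwards [z] with y hy _; simp)
  have hw := h2.ae_eq_zero isOpen_compl_singleton (hv.mono fun y hy _ => hy (mem_univ y))
  apply Lp.ext
  filter_upwards [z, hw, h3, compl_mem_ae_iff.mpr (measure_singleton (μ := volume) (0 : ℝ))]
    with y e1 e2 e3 e4
  have e5 := e2 e4
  simp_all

/-- The operator `-d²/dy² + q : H²(ℝ) ⊆ L²(ℝ) → L²(ℝ)`. Its graph is `regularGraph q`. -/
def regularOp (q : ℝ → ℝ) : L2 →ₗ.[ℂ] L2 := (regularGraph q).toLinearPMap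

/-- The operator `-d²/dy² + q - c δ₀` in `L²(ℝ)`. Its graph is `deltaGraph q c`. -/
def deltaOp (q : ℝ → ℝ) (c : ℝ) : L2 →ₗ.[ℂ] L2 := (deltaGraph q c).toLinearPMap

theorem regularOp_graph (q : ℝ → ℝ) : (regularOp q).graph = regularGraph q :=
  Submodule.toLinearPMap_graph_eq _ (regularGraph_single_valued q)

theorem deltaOp_graph (q : ℝ → ℝ) (c : ℝ) : (deltaOp q c).graph = deltaGraph q c :=
  Submodule.toLinearPMap_graph_eq _ (deltaGraph_single_valued q c)

/-- The resolvent set of an unbounded operator `L`: the `μ ∈ ℂ` for which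
`μ - L : D(L) → L²(ℝ)` is bijective with bounded inverse. -/
def resolvent (L : L2 →ₗ.[ℂ] L2) : Set ℂ :=
  {μ | Function.Bijective (fun u : L.domain => μ • (u : L2) - L u) ∧
    ∃ C : ℝ, ∀ u : L.domain, ‖(u : L2)‖ ≤ C * ‖μ • (u : L2) - L u‖}

/-- The kernel `{u ∈ D(L) | L u = 0}`. -/
def kernel (L : L2 →ₗ.[ℂ] L2) : Submodule ℂ L2 :=
  (LinearMap.ker L.toFun).map L.domain.subtype

/-- Zero is an isolated point of the spectrum and an eigenvalue with one-dimensional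
eigenspace. -/
def ZeroIsIsolatedSimpleEigenvalue (L : L2 →ₗ.[ℂ] L2) : Prop :=
  Module.finrank ℂ (kernel L) = 1 ∧
    ∃ ε : ℝ, 0 < ε ∧ ∀ μ : ℂ, 0 < ‖μ‖ → ‖μ‖ < ε → μ ∈ resolvent L

/-! ### The wave operators and the hypotheses of the existence theorem -/

/-- The coefficient `k² (1 - λ V₀(y) - W(y))`. -/
def waveCoeff (V₀ W : ℝ → ℝ) (k : ℕ) (lam : ℝ) (y : ℝ) : ℝ :=
  (k : ℝ) ^ 2 * (1 - lam * V₀ y - W y)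

/-- `L_{0,λ}^k = -d²/dy² + k² (1 - λ V₀ - W)` on `H²(ℝ)`. -/
def regularWaveOp (V₀ W : ℝ → ℝ) (k : ℕ) (lam : ℝ) : L2 →ₗ.[ℂ] L2 :=
  regularOp (waveCoeff V₀ W k lam)

/-- `L_λ^k = -d²/dy² + k² (1 - λ V₀ - W - α δ₀)`. -/
def waveOp (V₀ W : ℝ → ℝ) (α : ℝ) (k : ℕ) (lam : ℝ) : L2 →ₗ.[ℂ] L2 :=
  deltaOp (waveCoeff V₀ W k lam) ((k : ℝ) ^ 2 * α)

/-- `φ ∈ H²(0,∞)`, `-φ'' + q φ = 0` on `(0,∞)` and `φ(0) = 1`. -/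
def IsDecayingMode (q : ℝ → ℝ) (φ : ℝ → ℂ) : Prop :=
  MemLp φ 2 (volume.restrict (Ioi 0)) ∧
  (∃ v w : ℝ → ℂ, MemLp v 2 (volume.restrict (Ioi 0)) ∧ MemLp w 2 (volume.restrict (Ioi 0)) ∧
    IsWeakDeriv (Ioi 0) φ v ∧ IsWeakDeriv (Ioi 0) v w ∧
    ∀ᵐ y, y ∈ Ioi (0 : ℝ) → - w y + q y * φ y = 0) ∧
  HasTrace (𝓝[>] 0) φ 1

/-- Real distributions on the line. -/
abbrev LineDistribution : Type := 𝓓'((⊤ : TopologicalSpace.Opens ℝ), ℝ)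

/-- The distribution `η ↦ ∫ f η` of a locally integrable function `f`. -/
def regularDistribution (f : ℝ → ℝ) : LineDistribution :=
  TestFunction.integralAgainstBilinCLM (ContinuousLinearMap.mul ℝ ℝ) volume f

/-- The Dirac distribution at the origin. -/
def delta0 : LineDistribution := Distribution.delta (0 : ℝ)

/-- The hypotheses of the existence theorem for traveling waves with distributional `Γ`, at the
wavenumber `kstar` and the parameter value `lamstar`, for
`-Φ_yy - (1 - V(λ,y)) Φ_xx + Γ(y) (Φ³)_xx = 0`. The functions `V₀`, `W` (up to null sets) and the
numbers `α`, `γ` are determined by `V` and `Γ`. -/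
def ExistenceHypotheses (Γ : LineDistribution) (V : ℝ → LineDistribution) (kstar : ℕ)
    (lamstar : ℝ) : Prop :=
  ∃ (γ α : ℝ) (V₀ W : ℝ → ℝ),
    -- the form of the coefficients
    Γ = γ • delta0 ∧
    (∀ lam : ℝ, V lam = lam • regularDistribution V₀ + regularDistribution W + α • delta0) ∧
    -- `V₀` and `W` are bounded and even
    (MemLp V₀ ∞ volume ∧ MemLp W ∞ volume ∧ V₀.Even ∧ W.Even) ∧
    ∃ I J : Set ℝ,
      -- `0` lies in the resolvent set of the regular operators for `λ` in an interval `I`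
      (I.OrdConnected ∧
        ∀ k : ℕ, 1 ≤ k → ∀ lam ∈ I, (0 : ℂ) ∈ resolvent (regularWaveOp V₀ W k lam)) ∧
      -- on an open interval `J ⊆ I` around `lamstar`, zero is in the spectrum of the full operator
      -- only at `(kstar, lamstar)`, where it is an isolated simple eigenvalue
      (IsOpen J ∧ J.OrdConnected ∧ J ⊆ I ∧ lamstar ∈ J ∧
        ZeroIsIsolatedSimpleEigenvalue (waveOp V₀ W α kstar lamstar) ∧
        ∀ k : ℕ, 1 ≤ k → ∀ lam ∈ J, (k, lam) ≠ (kstar, lamstar) →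
          (0 : ℂ) ∈ resolvent (waveOp V₀ W α k lam)) ∧
      -- the decaying modes exist and are uniformly bounded in `L²(0,∞)`
      (∃ C : ℝ, 0 < C ∧ ∀ k : ℕ, 1 ≤ k → ∀ lam ∈ J,
        (∃ φ, IsDecayingMode (waveCoeff V₀ W k lam) φ) ∧
        ∀ φ, IsDecayingMode (waveCoeff V₀ W k lam) φ →
          eLpNorm φ 2 (volume.restrict (Ioi 0)) ≤ ENNReal.ofReal C) ∧
      -- transversality, for any `φ` that spans the kernel
      (∀ φ : L2, kernel (waveOp V₀ W α kstar lamstar) = Submodule.span ℂ {φ} →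
        ∫ y, V₀ y * ‖φ y‖ ^ 2 ≠ 0)

/-- The potential `V(λ,y) = λ 1_{|y| ≥ b} + β 1_{|y| < b} + α δ₀(y)`. -/
def stepPotential (β b α : ℝ) (lam : ℝ) : LineDistribution :=
  lam • regularDistribution ({y : ℝ | b ≤ |y|}.indicator 1) +
    β • regularDistribution ({y : ℝ | |y| < b}.indicator 1) + α • delta0

end TravelingWave

end

/-!
Since the potential is even, `L` is governed by the solution `ψ` of the half-line problem
`ψ'' = q ψ`, `ψ 0 = 1`, that lies in `H²(0, ∞)`. With `R` the solution operator of the two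
half-line Dirichlet problems, every solution of `L u = f` is `u = R f + s ψ(|y|)`, and pairing the
equation with `ψ(|y|)` turns the jump condition at the origin into the scalar equation
`(2 ψ'(0) + k² α) s = -⟨ψ(|·|), f⟩`. Hence `0 ∈ ρ(L)` exactly when `2 ψ'(0) + k² α ≠ 0`; otherwise
`ψ(|y|)` spans the kernel, and a Neumann series shows that zero is isolated in the spectrum.

For the step potential, `ψ'(0) = -k² P_k(√(1 - λ))` with `P_k` strictly decreasing in `k` and, for
every `k`, injective in `λ`, so `α = 2 P_{k_*}(√(1 - λ_*))` is resonant near `λ_*` at `(k_*, λ_*)`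
only. There `ψ` is a nonzero multiple of an exponential for `|y| ≥ b`, whence transversality.
-/

noncomputable section

namespace TravelingWave

/-! ### Primitives of integrable functions -/

section Primitive

variable {E F : Type*} [NormedAddCommGroup E] [NormedSpace ℝ E] [NormedAddCommGroup F]
  [NormedSpace ℝ F] {u v u₁ v₁ : ℝ → E} {s t : Set ℝ} {a b : ℝ}

/-- On the set `s`, the function `u` is a primitive of the locally integrable function `v`. This is
the working form of "`u` is locally absolutely continuous on the interval `s` with `u' = v` almost
everywhere". -/
def IsPrimitiveOn (u v : ℝ → E) (s : Set ℝ) : Prop :=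
  ∀ a ∈ s, ∀ b ∈ s, IntervalIntegrable v volume a b ∧ ∫ t in a..b, v t = u b - u a

theorem isPrimitiveOn_integral (hv : ∀ a b, IntervalIntegrable v volume a b) (s : Set ℝ) (c : E)
    (x₀ : ℝ) : IsPrimitiveOn (fun y => c + ∫ t in x₀..y, v t) v s := fun a _ b _ =>
  ⟨hv a b, by
    rw [add_sub_add_left_eq_sub, intervalIntegral.integral_interval_sub_left (hv x₀ b) (hv x₀ a)]⟩

theorem isPrimitiveOn_of_hasDerivAt [CompleteSpace E] (h : ∀ y, HasDerivAt u (v y) y)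
    (hv : Continuous v) (s : Set ℝ) : IsPrimitiveOn u v s := fun a _ b _ =>
  ⟨hv.intervalIntegrable a b, intervalIntegral.integral_eq_sub_of_hasDerivAt (fun y _ => h y)
    (hv.intervalIntegrable a b)⟩

namespace IsPrimitiveOn

theorem union (h : IsPrimitiveOn u v s) (h₁ : IsPrimitiveOn u v t) {c : ℝ} (hs : c ∈ s)
    (ht : c ∈ t) : IsPrimitiveOn u v (s ∪ t) := by
  have from_c : ∀ a ∈ s ∪ t, IntervalIntegrable v volume c a ∧ ∫ x in c..a, v x = u a - u c := by
    rintro a (ha | ha)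
    exacts [h c hs a ha, h₁ c ht a ha]
  intro a ha b hb
  obtain ⟨ia, ea⟩ := from_c a ha
  obtain ⟨ib, eb⟩ := from_c b hb
  refine ⟨ia.symm.trans ib, ?_⟩
  rw [← intervalIntegral.integral_interval_sub_left ib ia, ea, eb, sub_sub_sub_cancel_right]

theorem congr (h : IsPrimitiveOn u v s) (hu : ∀ y ∈ s, u y = u₁ y) : IsPrimitiveOn u₁ v s := by
  intro a ha b hb
  rw [← hu a ha, ← hu b hb]
  exact h a ha b hb

theorem congr_deriv (hs : s.OrdConnected) (h : IsPrimitiveOn u v s)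
    (hv : ∀ᵐ y, y ∈ s → v y = v₁ y) : IsPrimitiveOn u v₁ s := by
  intro a ha b hb
  obtain ⟨i, e⟩ := h a ha b hb
  have hv' : ∀ᵐ y, y ∈ uIoc a b → v y = v₁ y := by
    filter_upwards [hv] with y hy hy'
    exact hy (hs.uIcc_subset ha hb (uIoc_subset_uIcc hy'))
  exact ⟨i.congr_ae ((ae_restrict_iff' measurableSet_uIoc).2 hv'),
    (intervalIntegral.integral_congr_ae hv').symm.trans e⟩

theorem add (h : IsPrimitiveOn u v s) (h₁ : IsPrimitiveOn u₁ v₁ s) :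
    IsPrimitiveOn (fun y => u y + u₁ y) (fun y => v y + v₁ y) s := by
  intro a ha b hb
  obtain ⟨i, e⟩ := h a ha b hb
  obtain ⟨i₁, e₁⟩ := h₁ a ha b hb
  exact ⟨i.add i₁, by rw [intervalIntegral.integral_add i i₁, e, e₁, add_sub_add_comm]⟩

theorem clm_comp [CompleteSpace E] [CompleteSpace F] (L : E →L[ℝ] F) (h : IsPrimitiveOn u v s) :
    IsPrimitiveOn (fun y => L (u y)) (fun y => L (v y)) s := by
  intro a ha b hb
  obtain ⟨i, e⟩ := h a ha b hb
  refine ⟨⟨L.integrable_comp i.1, L.integrable_comp i.2⟩, ?_⟩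
  rw [L.intervalIntegral_comp_comm i, e, map_sub]

theorem sub [CompleteSpace E] (h : IsPrimitiveOn u v s) (h₁ : IsPrimitiveOn u₁ v₁ s) :
    IsPrimitiveOn (fun y => u y - u₁ y) (fun y => v y - v₁ y) s := by
  simpa [sub_eq_add_neg] using h.add (h₁.clm_comp (-ContinuousLinearMap.id ℝ E))

theorem ofReal {f g : ℝ → ℝ} (h : IsPrimitiveOn f g s) :
    IsPrimitiveOn (fun y => (f y : ℂ)) (fun y => (g y : ℂ)) s :=
  h.clm_comp Complex.ofRealCLM

theorem const_mul {u v : ℝ → ℂ} (c : ℂ) (h : IsPrimitiveOn u v s) :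
    IsPrimitiveOn (fun y => c * u y) (fun y => c * v y) s :=
  h.clm_comp (ContinuousLinearMap.mul ℝ ℂ c)

theorem eq_add_integral (h : IsPrimitiveOn u v s) (ha : a ∈ s) (hb : b ∈ s) :
    u b = u a + ∫ t in a..b, v t := by
  rw [(h a ha b hb).2, add_sub_cancel]

theorem continuousOn_uIcc (hs : s.OrdConnected) (h : IsPrimitiveOn u v s) (ha : a ∈ s)
    (hb : b ∈ s) : ContinuousOn u (uIcc a b) :=
  (continuousOn_const.add
    (intervalIntegral.continuousOn_primitive_interval' (h a ha b hb).1 left_mem_uIcc)).congr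
      fun _ hx => h.eq_add_integral ha (hs.uIcc_subset ha hb hx)

theorem continuousOn_Ici (h : IsPrimitiveOn u v (Ici a)) : ContinuousOn u (Ici a) := by
  intro x (hx : a ≤ x)
  have hc := h.continuousOn_uIcc ordConnected_Ici self_mem_Ici (hx.trans (le_add_of_nonneg_right
    zero_le_one) : a ≤ x + 1)
  rw [uIcc_of_le (by linarith)] at hc
  exact (hc x ⟨hx, by linarith⟩).mono_of_mem_nhdsWithin
    (mem_nhdsWithin.2 ⟨Iio (x + 1), isOpen_Iio, by simp, fun y hy => ⟨hy.2, hy.1.le⟩⟩)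

end IsPrimitiveOn

theorem absolutelyContinuousOnInterval_integral (h : IntervalIntegrable v volume a b) :
    AbsolutelyContinuousOnInterval (fun x => ∫ t in a..x, v t) a b := by
  have hnorm := h.norm.absolutelyContinuousOnInterval_intervalIntegral (c := a) left_mem_uIcc
  unfold AbsolutelyContinuousOnInterval at hnorm ⊢
  refine squeeze_zero' (Eventually.of_forall fun _ => Finset.sum_nonneg fun i _ => dist_nonneg)
    ?_ hnorm
  rw [eventually_inf_principal]
  filter_upwards with I hI
  refine Finset.sum_le_sum fun i hi => ?_
  obtain ⟨hx, hy⟩ := hI.1 i hi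
  have integrable_to {x : ℝ} (hx : x ∈ uIcc a b) : IntervalIntegrable v volume a x :=
    h.mono_set (uIcc_subset_uIcc left_mem_uIcc hx)
  rw [dist_eq_norm, dist_eq_norm,
    intervalIntegral.integral_interval_sub_left (integrable_to hx) (integrable_to hy),
    intervalIntegral.integral_interval_sub_left (integrable_to hx).norm (integrable_to hy).norm,
    Real.norm_eq_abs]
  exact intervalIntegral.norm_integral_le_abs_integral_norm

theorem IsPrimitiveOn.smul [CompleteSpace E] {f g : ℝ → ℝ} (hs : s.OrdConnected)
    (hf : IsPrimitiveOn f g s) (hu : IsPrimitiveOn u v s) :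
    IsPrimitiveOn (fun y => f y • u y) (fun y => g y • u y + f y • v y) s := by
  intro a ha b hb
  have hsub := hs.uIcc_subset ha hb
  have ig := (hf a ha b hb).1
  have iv := (hu a ha b hb).1
  have iw : IntervalIntegrable (fun y => g y • u y + f y • v y) volume a b :=
    (ig.smul_continuousOn (hu.continuousOn_uIcc hs ha hb)).add
      (iv.continuousOn_smul (hf.continuousOn_uIcc hs ha hb))
  refine ⟨iw, ?_⟩
  -- The difference of the two sides is absolutely continuous with vanishing derivative.
  have hac := (((contDiffOn_const (c := f a)).absolutelyContinuousOnInterval.fun_add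
    (absolutelyContinuousOnInterval_integral ig)).fun_smul
      ((contDiffOn_const (c := u a)).absolutelyContinuousOnInterval.fun_add
        (absolutelyContinuousOnInterval_integral iv))).fun_sub
    (absolutelyContinuousOnInterval_integral iw)
  obtain ⟨c, hc⟩ := hac.const_of_ae_hasDerivAt_zero (by
    filter_upwards [ig.ae_hasDerivAt_integral, iv.ae_hasDerivAt_integral,
      iw.ae_hasDerivAt_integral] with x df du dw hx
    refine ((((df hx a left_mem_uIcc).const_add (f a)).smul
      ((du hx a left_mem_uIcc).const_add (u a))).sub (dw hx a left_mem_uIcc)).congr_deriv ?_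
    rw [← hf.eq_add_integral ha (hsub hx), ← hu.eq_add_integral ha (hsub hx), add_comm, sub_self])
  have at_a := hc a left_mem_uIcc
  have at_b := hc b right_mem_uIcc
  simp only [intervalIntegral.integral_same, add_zero, sub_zero] at at_a
  rw [← hf.eq_add_integral ha hb, ← hu.eq_add_integral ha hb, ← at_a] at at_b
  rw [eq_sub_iff_add_eq', ← sub_eq_iff_eq_add.1 at_b]

theorem exists_forall_ge_eq_zero_of_hasCompactSupport {η : ℝ → ℝ} (hη : HasCompactSupport η)
    (a : ℝ) : ∃ b, a < b ∧ ∀ y, b ≤ y → η y = 0 := by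
  obtain ⟨r, hr⟩ := hη.isCompact.bddAbove
  refine ⟨max a r + 1, by linarith [le_max_left a r], fun y hy => ?_⟩
  refine image_eq_zero_of_notMem_tsupport fun hmem => ?_
  linarith [hr hmem, le_max_right a r]

theorem setIntegral_Ioi_eq_intervalIntegral_of_forall_ge (hab : a ≤ b)
    (h : ∀ y, b ≤ y → u y = 0) : ∫ y in Ioi a, u y = ∫ y in a..b, u y := by
  rw [intervalIntegral.integral_of_le hab]
  refine setIntegral_eq_of_subset_of_forall_sdiff_eq_zero measurableSet_Ioi
    (fun y hy => hy.1) fun y hy => h y ?_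
  by_contra hlt
  exact hy.2 ⟨hy.1, (not_le.1 hlt).le⟩

theorem IsPrimitiveOn.setIntegral_Ioi_deriv_smul [CompleteSpace E] (h : IsPrimitiveOn u v (Ici a))
    {η : ℝ → ℝ} (hη : ContDiff ℝ 1 η) (hc : HasCompactSupport η) :
    ∫ y in Ioi a, deriv η y • u y = - (η a • u a) - ∫ y in Ioi a, η y • v y := by
  have hη' : Continuous (deriv η) := hη.continuous_deriv le_rfl
  obtain ⟨b₁, hab₁, h₁⟩ := exists_forall_ge_eq_zero_of_hasCompactSupport hc a
  obtain ⟨b, hb₁, hb⟩ := exists_forall_ge_eq_zero_of_hasCompactSupport hc.deriv b₁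
  have hab : a < b := hab₁.trans hb₁
  have hηb (y : ℝ) (hy : b ≤ y) : η y = 0 := h₁ y (hb₁.le.trans hy)
  have hprim : IsPrimitiveOn η (deriv η) (Ici a) := isPrimitiveOn_of_hasDerivAt
    (fun y => (hη.differentiable one_ne_zero y).hasDerivAt) hη' _
  have i₁ : IntervalIntegrable (fun y => deriv η y • u y) volume a b :=
    (hη'.continuousOn.smul (h.continuousOn_uIcc ordConnected_Ici self_mem_Ici
      (show b ∈ Ici a from hab.le))).intervalIntegrable
  have i₂ : IntervalIntegrable (fun y => η y • v y) volume a b :=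
    (h a self_mem_Ici b hab.le).1.continuousOn_smul hη.continuous.continuousOn
  have hparts := (hprim.smul ordConnected_Ici h a self_mem_Ici b hab.le).2
  simp only [intervalIntegral.integral_add i₁ i₂, hηb b le_rfl, zero_smul, zero_sub] at hparts
  rw [setIntegral_Ioi_eq_intervalIntegral_of_forall_ge hab.le fun y hy => by
      rw [hb y hy, zero_smul],
    setIntegral_Ioi_eq_intervalIntegral_of_forall_ge hab.le fun y hy => by
      rw [hηb y hy, zero_smul], ← hparts, add_sub_cancel_right]

end Primitive

/-! ### Weak derivatives on the half line -/

theorem exists_deriv_eq_of_integral_eq_zero {U : Set ℝ} (hU : U.OrdConnected) {ζ : ℝ → ℝ}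
    (hζ : ContDiff ℝ ∞ ζ) (hc : HasCompactSupport ζ) (hsub : tsupport ζ ⊆ U)
    (hint : ∫ y, ζ y = 0) :
    ∃ η : ℝ → ℝ, ContDiff ℝ ∞ η ∧ HasCompactSupport η ∧ tsupport η ⊆ U ∧ deriv η = ζ := by
  obtain ⟨a, b, hζab, habU⟩ : ∃ a b, tsupport ζ ⊆ Icc a b ∧ Icc a b ⊆ U := by
    rcases (tsupport ζ).eq_empty_or_nonempty with hempty | hne
    · exact ⟨1, 0, by simp [hempty], by simp⟩
    · obtain ⟨a, ha, hmin⟩ := hc.isCompact.exists_isLeast hne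
      obtain ⟨b, hb, hmax⟩ := hc.isCompact.exists_isGreatest hne
      exact ⟨a, b, fun y hy => ⟨hmin hy, hmax hy⟩, hU.out (hsub ha) (hsub hb)⟩
  have hζ0 (y : ℝ) (hy : y ∉ Icc a b) : ζ y = 0 :=
    image_eq_zero_of_notMem_tsupport fun h => hy (hζab h)
  have hi : Integrable ζ := hζ.continuous.integrable_of_hasCompactSupport hc
  set η : ℝ → ℝ := fun x => ∫ y in Iic x, ζ y with hη
  have hd (x : ℝ) : HasDerivAt η (ζ x) x := by
    have hη_eq : η = fun x => (∫ y in Iic 0, ζ y) + ∫ y in (0 : ℝ)..x, ζ y := funext fun x => by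
      rw [← intervalIntegral.integral_Iic_sub_Iic hi.integrableOn hi.integrableOn, hη,
        add_sub_cancel]
    rw [hη_eq]
    exact (hζ.continuous.integral_hasStrictDerivAt 0 x).hasDerivAt.const_add _
  have hη' : deriv η = ζ := funext fun x => (hd x).deriv
  have hηab : tsupport η ⊆ Icc a b := by
    refine closure_minimal (fun x hx => ?_) isClosed_Icc
    by_contra hout
    refine hx ?_
    rcases not_and_or.1 hout with hxa | hbx
    · exact setIntegral_eq_zero_of_forall_eq_zero fun y hy => hζ0 y fun h => hxa (h.1.trans hy)
    · refine (setIntegral_eq_integral_of_forall_compl_eq_zero fun y hy => hζ0 y fun h => ?_).trans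
        hint
      exact hbx ((not_le.1 hy).le.trans h.2)
  exact ⟨η, contDiff_infty_iff_deriv.2 ⟨fun x => (hd x).differentiableAt, by rwa [hη']⟩,
    isCompact_Icc.of_isClosed_subset (isClosed_tsupport η) hηab, hηab.trans habU, hη'⟩

theorem exists_testFunction_integral_eq_one {U : Set ℝ} (hU : IsOpen U) (hne : U.Nonempty) :
    ∃ ρ : ℝ → ℝ, ContDiff ℝ ∞ ρ ∧ HasCompactSupport ρ ∧ tsupport ρ ⊆ U ∧ ∫ y, ρ y = 1 := by
  obtain ⟨x, hx⟩ := hne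
  obtain ⟨r, hr, hball⟩ := Metric.isOpen_iff.1 hU x hx
  let bump : ContDiffBump x := ⟨r / 4, r / 2, by positivity, by linarith⟩
  refine ⟨bump.normed volume, bump.contDiff_normed, bump.hasCompactSupport_normed, ?_,
    bump.integral_normed⟩
  rw [bump.tsupport_normed_eq]
  exact (Metric.closedBall_subset_ball (half_lt_self hr)).trans hball

theorem exists_ae_eq_const_of_integral_deriv_smul_eq_zero {E : Type*} [NormedAddCommGroup E]
    [NormedSpace ℝ E] [CompleteSpace E] {U : Set ℝ} (hU : IsOpen U) (hconn : U.OrdConnected)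
    {w : ℝ → E} (hw : LocallyIntegrable w)
    (h : ∀ η : ℝ → ℝ, ContDiff ℝ ∞ η → HasCompactSupport η → tsupport η ⊆ U →
      ∫ y, deriv η y • w y = 0) :
    ∃ c : E, ∀ᵐ y, y ∈ U → w y = c := by
  rcases U.eq_empty_or_nonempty with rfl | hne
  · exact ⟨0, by simp⟩
  obtain ⟨ρ, hρ, hρc, hρU, hρ1⟩ := exists_testFunction_integral_eq_one hU hne
  have iρ : Integrable ρ := hρ.continuous.integrable_of_hasCompactSupport hρc
  have iρw := hw.integrable_smul_left_of_hasCompactSupport hρ.continuous hρc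
  set c : E := ∫ y, ρ y • w y
  have hwc : LocallyIntegrable (fun y => w y - c) :=
    hw.sub continuous_const.locallyIntegrable
  suffices hzero : ∀ᵐ y, y ∈ U → w y - c = 0 from
    ⟨c, hzero.mono fun y hy hyU => sub_eq_zero.1 (hy hyU)⟩
  refine hU.ae_eq_zero_of_integral_contDiff_smul_eq_zero (hwc.locallyIntegrableOn _)
    fun ζ hζ hζc hζU => ?_
  have iζ : Integrable ζ := hζ.continuous.integrable_of_hasCompactSupport hζc
  have iζw := hw.integrable_smul_left_of_hasCompactSupport hζ.continuous hζc
  set J : ℝ := ∫ y, ζ y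
  -- Subtracting the multiple `J ρ` makes the test function `ζ` a derivative.
  obtain ⟨η, hη, hηc, hηU, hη'⟩ := exists_deriv_eq_of_integral_eq_zero hconn
    (ζ := fun y => ζ y - J * ρ y) (hζ.sub (contDiff_const.mul hρ)) (hζc.sub hρc.mul_left)
    ((tsupport_sub _ _).trans (union_subset hζU (tsupport_mul_subset_right.trans hρU)))
    (by rw [integral_sub iζ (iρ.const_mul J), integral_const_mul, hρ1, mul_one, sub_self])
  have horth := h η hη hηc hηU
  simp only [hη', sub_smul, mul_smul] at horth
  rw [integral_sub iζw (show Integrable (fun y => J • ρ y • w y) from iρw.smul J), integral_smul,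
    sub_eq_zero] at horth
  simp only [smul_sub]
  rw [integral_sub iζw (iζ.smul_const c), integral_smul_const, horth, sub_self]

theorem integral_smul_eq_setIntegral_of_tsupport_subset {E : Type*} [NormedAddCommGroup E]
    [NormedSpace ℝ E] {U : Set ℝ} {η : ℝ → ℝ} (h : tsupport η ⊆ U) (u : ℝ → E) :
    ∫ y, η y • u y = ∫ y in U, η y • u y :=
  (setIntegral_eq_integral_of_forall_compl_eq_zero fun y hy => by
    rw [image_eq_zero_of_notMem_tsupport fun hmem => hy (h hmem), zero_smul]).symm

theorem isWeakDeriv_congr_on {U : Set ℝ} (hU : MeasurableSet U) {u u₁ v v₁ : ℝ → ℂ}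
    (hu : ∀ᵐ y, y ∈ U → u y = u₁ y) (hv : ∀ᵐ y, y ∈ U → v y = v₁ y) :
    IsWeakDeriv U u v ↔ IsWeakDeriv U u₁ v₁ := by
  have setIntegral_congr {w w₁ : ℝ → ℂ} (hw : ∀ᵐ y, y ∈ U → w y = w₁ y) (η : ℝ → ℝ) :
      ∫ y in U, η y • w y = ∫ y in U, η y • w₁ y :=
    setIntegral_congr_ae hU (hw.mono fun y hy hyU => by rw [hy hyU])
  refine forall₄_congr fun η _ _ hηU => ?_
  rw [integral_smul_eq_setIntegral_of_tsupport_subset (tsupport_deriv_subset.trans hηU) u,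
    integral_smul_eq_setIntegral_of_tsupport_subset (tsupport_deriv_subset.trans hηU) u₁,
    integral_smul_eq_setIntegral_of_tsupport_subset hηU v,
    integral_smul_eq_setIntegral_of_tsupport_subset hηU v₁, setIntegral_congr hu,
    setIntegral_congr hv]

theorem IsPrimitiveOn.isWeakDeriv_Ioi {u v : ℝ → ℂ} {a : ℝ} (h : IsPrimitiveOn u v (Ici a)) :
    IsWeakDeriv (Ioi a) u v := by
  intro η hη hηc hηU
  have hηa : η a = 0 := image_eq_zero_of_notMem_tsupport fun hmem => lt_irrefl a (hηU hmem)
  rw [integral_smul_eq_setIntegral_of_tsupport_subset (tsupport_deriv_subset.trans hηU),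
    integral_smul_eq_setIntegral_of_tsupport_subset hηU,
    h.setIntegral_Ioi_deriv_smul (hη.of_le (by simp)) hηc, hηa, zero_smul, neg_zero, zero_sub]

theorem IsWeakDeriv.exists_isPrimitiveOn {u v : ℝ → ℂ} {a : ℝ}
    (hu : MemLp u 2 (volume.restrict (Ioi a))) (hv : MemLp v 2 (volume.restrict (Ioi a)))
    (h : IsWeakDeriv (Ioi a) u v) :
    ∃ U, IsPrimitiveOn U v (Ici a) ∧ ∀ᵐ y, y ∈ Ioi a → u y = U y := by
  have locallyIntegrable {w : ℝ → ℂ} (hw : MemLp w 2 (volume.restrict (Ioi a))) :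
      LocallyIntegrable ((Ioi a).indicator w) :=
    ((memLp_indicator_iff_restrict measurableSet_Ioi).2 hw).locallyIntegrable (by norm_num)
  have ind (w : ℝ → ℂ) : ∀ᵐ y, y ∈ Ioi a → (Ioi a).indicator w y = w y :=
    Eventually.of_forall fun y hy => indicator_of_mem hy w
  have hvi (x y : ℝ) : IntervalIntegrable ((Ioi a).indicator v) volume x y :=
    ((locallyIntegrable hv).integrableOn_isCompact isCompact_uIcc).intervalIntegrable
  set V : ℂ → ℝ → ℂ := fun c y => c + ∫ t in a..y, (Ioi a).indicator v t
  have hV (c : ℂ) : IsPrimitiveOn (V c) ((Ioi a).indicator v) (Ici a) :=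
    isPrimitiveOn_integral hvi _ c a
  have hVloc : LocallyIntegrable (V 0) :=
    (continuous_const.add (intervalIntegral.continuous_primitive hvi a)).locallyIntegrable
  obtain ⟨c, hc⟩ := exists_ae_eq_const_of_integral_deriv_smul_eq_zero isOpen_Ioi ordConnected_Ioi
    ((locallyIntegrable hu).sub hVloc) fun η hη hηc hηU => by
      have hη' : Continuous (deriv η) := hη.continuous_deriv (by simp)
      have hu' := (isWeakDeriv_congr_on measurableSet_Ioi (ind u) (ind v)).2 h η hη hηc hηU
      simp only [Pi.sub_apply, smul_sub]
      rw [integral_sub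
        ((locallyIntegrable hu).integrable_smul_left_of_hasCompactSupport hη' hηc.deriv)
        (hVloc.integrable_smul_left_of_hasCompactSupport hη' hηc.deriv), hu',
        (hV 0).isWeakDeriv_Ioi η hη hηc hηU, sub_self]
  refine ⟨V c, (hV c).congr_deriv ordConnected_Ici ?_, ?_⟩
  · filter_upwards [volume.ae_ne a] with y hya hy
    exact indicator_of_mem (lt_of_le_of_ne hy hya.symm) v
  · filter_upwards [hc, ind u] with y hy hyu hya
    rw [← hyu hya, ← sub_eq_zero]
    have := hy hya
    simp only [V, Pi.sub_apply, zero_add] at this ⊢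
    linear_combination this

/-! ### Solutions on the half line -/

/-- `u ∈ H²(0,∞)` solves `-u'' + q u = f` on the half line, `v` being the derivative of `u`. Both
`u` and `v` are the representatives that are continuous on `[0,∞)`. -/
structure IsHalfLineSolution (q : ℝ → ℝ) (u v f : ℝ → ℂ) : Prop where
  memLp : MemLp u 2 (volume.restrict (Ioi 0))
  memLp_deriv : MemLp v 2 (volume.restrict (Ioi 0))
  prim : IsPrimitiveOn u v (Ici 0)
  prim_deriv : IsPrimitiveOn v (fun y => q y • u y - f y) (Ici 0)

theorem IsHalfLineSolution.add {q : ℝ → ℝ} {u v f u₁ v₁ f₁ : ℝ → ℂ}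
    (h : IsHalfLineSolution q u v f) (h₁ : IsHalfLineSolution q u₁ v₁ f₁) :
    IsHalfLineSolution q (fun y => u y + u₁ y) (fun y => v y + v₁ y) (fun y => f y + f₁ y) where
  memLp := h.memLp.add h₁.memLp
  memLp_deriv := h.memLp_deriv.add h₁.memLp_deriv
  prim := h.prim.add h₁.prim
  prim_deriv := by
    convert h.prim_deriv.add h₁.prim_deriv using 2
    rw [smul_add, add_sub_add_comm]

theorem IsHalfLineSolution.const_mul {q : ℝ → ℝ} {u v f : ℝ → ℂ} (c : ℂ)
    (h : IsHalfLineSolution q u v f) :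
    IsHalfLineSolution q (fun y => c * u y) (fun y => c * v y) (fun y => c * f y) where
  memLp := h.memLp.const_mul c
  memLp_deriv := h.memLp_deriv.const_mul c
  prim := h.prim.const_mul c
  prim_deriv := by
    convert h.prim_deriv.const_mul c using 2
    rw [mul_sub, mul_smul_comm]

theorem wronskian_eq {E : Type*} [NormedAddCommGroup E] [NormedSpace ℝ E] [CompleteSpace E]
    {q f g : ℝ → ℝ} {u v : ℝ → E} {s : Set ℝ} (hs : s.OrdConnected) (hf : IsPrimitiveOn f g s)
    (hg : IsPrimitiveOn g (fun y => q y • f y) s) (hu : IsPrimitiveOn u v s)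
    (hv : IsPrimitiveOn v (fun y => q y • u y) s) {x y : ℝ} (hx : x ∈ s) (hy : y ∈ s) :
    f y • v y - g y • u y = f x • v x - g x • u x := by
  have hconst := (((hf.smul hs hv).sub (hg.smul hs hu)) x hx y hy).2
  rw [intervalIntegral.integral_congr (g := fun _ => 0) (fun t _ => by module),
    intervalIntegral.integral_zero] at hconst
  exact (sub_eq_zero.1 hconst.symm)

/-- `u` solves `-u'' + q u = 0` on `[0,∞)` with `u' = v`, and both functions are bounded by
`M e^{r y}` there. Their values on `(-∞,0)` only matter for measurability. -/
structure IsExpBoundedSolution (q u v : ℝ → ℝ) (M r : ℝ) : Prop where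
  continuous : Continuous u
  continuous_deriv : Continuous v
  prim : IsPrimitiveOn u v (Ici 0)
  prim_deriv : IsPrimitiveOn v (fun y => q y • u y) (Ici 0)
  abs_le : ∀ y, 0 ≤ y → |u y| ≤ M * Real.exp (r * y)
  abs_deriv_le : ∀ y, 0 ≤ y → |v y| ≤ M * Real.exp (r * y)

theorem memLp_two_exp_mul_Ioi {r : ℝ} (hr : r < 0) (a : ℝ) :
    MemLp (fun y : ℝ => Real.exp (r * y)) 2 (volume.restrict (Ioi a)) := by
  rw [memLp_two_iff_integrable_sq (by fun_prop)]
  refine (integrableOn_exp_mul_Ioi (a := 2 * r) (by linarith) a).congr_fun (fun y _ => ?_)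
    measurableSet_Ioi
  simp only [← Real.exp_nat_mul, mul_assoc, Nat.cast_ofNat]

theorem memLp_two_of_abs_le_exp {g : ℝ → ℝ} (hg : Continuous g) {M r : ℝ} (hr : r < 0)
    (h : ∀ y, 0 ≤ y → |g y| ≤ M * Real.exp (r * y)) :
    MemLp (fun y => (g y : ℂ)) 2 (volume.restrict (Ioi 0)) := by
  refine ((memLp_two_exp_mul_Ioi hr 0).const_mul M).mono'
    (Complex.continuous_ofReal.comp hg).aestronglyMeasurable ?_
  filter_upwards [ae_restrict_mem measurableSet_Ioi] with y hy
  rw [Complex.norm_real]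
  exact h y (le_of_lt hy)

theorem IsExpBoundedSolution.isHalfLineSolution {q u v : ℝ → ℝ} {M r : ℝ} (hr : r < 0)
    (h : IsExpBoundedSolution q u v M r) :
    IsHalfLineSolution q (fun y => (u y : ℂ)) (fun y => (v y : ℂ)) 0 where
  memLp := memLp_two_of_abs_le_exp h.continuous hr h.abs_le
  memLp_deriv := memLp_two_of_abs_le_exp h.continuous_deriv hr h.abs_deriv_le
  prim := h.prim.ofReal
  prim_deriv := by simpa using h.prim_deriv.ofReal

/-- A fundamental system of `-u'' + q u = 0` on the half line: the decaying solution `ψ` with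
`ψ(0) = 1` and a solution `θ` of at most the inverse exponential growth with `θ(0) = 0` and
`θ'(0) = 1`. -/
structure HalfLineBasis (q : ℝ → ℝ) where
  ψ : ℝ → ℝ
  dψ : ℝ → ℝ
  θ : ℝ → ℝ
  dθ : ℝ → ℝ
  rate : ℝ
  bound : ℝ
  rate_pos : 0 < rate
  decaying : IsExpBoundedSolution q ψ dψ bound (-rate)
  growing : IsExpBoundedSolution q θ dθ bound rate
  ψ_zero : ψ 0 = 1
  θ_zero : θ 0 = 0
  dθ_zero : dθ 0 = 1

namespace HalfLineBasis

variable {q : ℝ → ℝ} (B : HalfLineBasis q)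

/-- The derivative at the origin of the decaying solution. -/
def slope : ℝ := B.dψ 0

theorem bound_nonneg : 0 ≤ B.bound := by
  simpa using (abs_nonneg _).trans (B.decaying.abs_le 0 le_rfl)

theorem isHalfLineSolution_ψ :
    IsHalfLineSolution q (fun y => (B.ψ y : ℂ)) (fun y => (B.dψ y : ℂ)) 0 :=
  B.decaying.isHalfLineSolution (neg_lt_zero.2 B.rate_pos)

theorem wronskian {y : ℝ} (hy : 0 ≤ y) : B.ψ y * B.dθ y - B.dψ y * B.θ y = 1 := by
  simpa [B.ψ_zero, B.θ_zero, B.dθ_zero] using wronskian_eq ordConnected_Ici B.decaying.prim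
    B.decaying.prim_deriv B.growing.prim B.growing.prim_deriv self_mem_Ici hy

variable {B} in
theorem wronskian_ψ_eq_zero {u v : ℝ → ℂ} (h : IsHalfLineSolution q u v 0) {y : ℝ} (hy : 0 ≤ y) :
    B.ψ y * v y - B.dψ y * u y = 0 := by
  have hd : IsPrimitiveOn v (fun y => q y • u y) (Ici 0) := by simpa using h.prim_deriv
  have hconst (x : ℝ) (hx : 0 ≤ x) := wronskian_eq ordConnected_Ici B.decaying.prim
    B.decaying.prim_deriv h.prim hd (mem_Ici.2 hy) (mem_Ici.2 hx)
  simp only [Complex.real_smul] at hconst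
  -- The Wronskian is constant and integrable on the half line.
  have hi : Integrable (fun _ : ℝ => B.ψ y * v y - B.dψ y * u y) (volume.restrict (Ioi 0)) := by
    refine ((B.isHalfLineSolution_ψ.memLp.integrable_mul h.memLp_deriv).sub
      (B.isHalfLineSolution_ψ.memLp_deriv.integrable_mul h.memLp)).congr ?_
    filter_upwards [ae_restrict_mem measurableSet_Ioi] with x hx
    exact hconst x (le_of_lt hx)
  exact (integrable_const_iff.1 hi).resolve_right fun hfin =>
    absurd hfin.measure_univ_lt_top (by simp)

theorem eq_zero_of_isHalfLineSolution (B : HalfLineBasis q) {u v : ℝ → ℂ}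
    (h : IsHalfLineSolution q u v 0) (h0 : u 0 = 0) {y : ℝ} (hy : 0 ≤ y) : u y = 0 ∧ v y = 0 := by
  have hd : IsPrimitiveOn v (fun y => q y • u y) (Ici 0) := by simpa using h.prim_deriv
  have wψ : B.ψ y * v y - B.dψ y * u y = 0 := wronskian_ψ_eq_zero h hy
  have wθ : B.θ y * v y - B.dθ y * u y = 0 := by
    simpa [B.θ_zero, h0] using wronskian_eq ordConnected_Ici B.growing.prim B.growing.prim_deriv
      h.prim hd self_mem_Ici (mem_Ici.2 hy)
  have w : (B.ψ y * B.dθ y - B.dψ y * B.θ y : ℂ) = 1 := by exact_mod_cast B.wronskian hy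
  constructor
  · linear_combination (-u y) * w + B.θ y * wψ - B.ψ y * wθ
  · linear_combination (-v y) * w + B.dθ y * wψ - B.dψ y * wθ

theorem isHalfLineSolution_unique (B : HalfLineBasis q) {u v u₁ v₁ f : ℝ → ℂ}
    (h : IsHalfLineSolution q u v f) (h₁ : IsHalfLineSolution q u₁ v₁ f) (h0 : u 0 = u₁ 0)
    {y : ℝ} (hy : 0 ≤ y) :
    u y = u₁ y ∧ v y = v₁ y := by
  have hdiff := h.add (h₁.const_mul (-1))
  have hf : (fun y => f y + -1 * f y) = (0 : ℝ → ℂ) := by ext y; simp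
  rw [hf] at hdiff
  obtain ⟨hu, hv⟩ := B.eq_zero_of_isHalfLineSolution hdiff (by simp [h0]) hy
  exact ⟨by linear_combination hu, by linear_combination hv⟩

end HalfLineBasis

/-! ### Integral operators with exponentially decaying kernels -/

theorem sq_lintegral_mul_le {α : Type*} [MeasurableSpace α] {μ : Measure α} {k h : α → ℝ≥0∞}
    (hk : AEMeasurable k μ) (hh : AEMeasurable h μ) :
    (∫⁻ s, k s * h s ∂μ) ^ 2 ≤ (∫⁻ s, k s ∂μ) * ∫⁻ s, k s * h s ^ 2 ∂μ := by
  have sqrt_mul_sqrt (x : ℝ≥0∞) : x ^ (1 / 2 : ℝ) * x ^ (1 / 2 : ℝ) = x := by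
    rw [← ENNReal.rpow_add_of_nonneg _ _ (by norm_num) (by norm_num)]
    norm_num
  have sq_sqrt (x : ℝ≥0∞) : (x ^ (1 / 2 : ℝ)) ^ 2 = x := by rw [sq, sqrt_mul_sqrt]
  have hölder := ENNReal.lintegral_mul_le_Lp_mul_Lq μ Real.HolderConjugate.two_two
    (f := fun s => k s ^ (1 / 2 : ℝ)) (g := fun s => k s ^ (1 / 2 : ℝ) * h s)
    (hk.pow_const _) ((hk.pow_const _).mul hh)
  simp only [Pi.mul_apply, ← mul_assoc, sqrt_mul_sqrt, ENNReal.rpow_two, mul_pow,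
    sq_sqrt] at hölder
  refine (ENNReal.pow_le_pow_left hölder).trans_eq ?_
  rw [mul_pow, sq_sqrt, sq_sqrt]

theorem lintegral_sq_lintegral_mul_le_of_schur {α β : Type*} [MeasurableSpace α] [MeasurableSpace β]
    {μ : Measure α} {ν : Measure β} [SFinite μ] [SFinite ν] {k : α → β → ℝ≥0∞}
    (hk : Measurable (Function.uncurry k)) {h : β → ℝ≥0∞} (hh : AEMeasurable h ν) {A A' : ℝ≥0∞}
    (hrow : ∀ y, ∫⁻ s, k y s ∂ν ≤ A) (hcol : ∀ s, ∫⁻ y, k y s ∂μ ≤ A') :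
    ∫⁻ y, (∫⁻ s, k y s * h s ∂ν) ^ 2 ∂μ ≤ A * A' * ∫⁻ s, h s ^ 2 ∂ν := by
  have hkh : AEMeasurable (Function.uncurry fun y s => k y s * h s ^ 2) (μ.prod ν) :=
    hk.aemeasurable.mul (hh.comp_snd.pow_const 2)
  calc ∫⁻ y, (∫⁻ s, k y s * h s ∂ν) ^ 2 ∂μ
      ≤ ∫⁻ y, A * ∫⁻ s, k y s * h s ^ 2 ∂ν ∂μ := lintegral_mono fun y =>
        (sq_lintegral_mul_le (hk.comp measurable_prodMk_left).aemeasurable hh).trans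
          (mul_le_mul_left (hrow y) _)
    _ = A * ∫⁻ s, ∫⁻ y, k y s * h s ^ 2 ∂μ ∂ν := by
        rw [lintegral_const_mul'', lintegral_lintegral_swap hkh]
        exact AEMeasurable.lintegral_prod_right' (f := fun p : α × β => k p.1 p.2 * h p.2 ^ 2) hkh
    _ ≤ A * ∫⁻ s, A' * h s ^ 2 ∂ν := by
        refine mul_le_mul_right (lintegral_mono fun s => ?_) _
        have hm : Measurable fun y => k y s := hk.comp measurable_prodMk_right
        rw [lintegral_mul_const _ hm]
        exact mul_le_mul_left (hcol s) _
    _ = A * A' * ∫⁻ s, h s ^ 2 ∂ν := by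
        rw [lintegral_const_mul'' _ (hh.pow_const 2), mul_assoc]

theorem eLpNorm_two_sq {α E : Type*} [MeasurableSpace α] [ENorm E] (μ : Measure α) (f : α → E) :
    eLpNorm f 2 μ ^ 2 = ∫⁻ x, ‖f x‖ₑ ^ 2 ∂μ := by
  simpa using eLpNorm_nnreal_pow_eq_lintegral (p := 2) (f := f) (μ := μ) two_ne_zero

theorem integral_exp_neg_mul_abs {r : ℝ} (hr : 0 < r) :
    ∫ x : ℝ, Real.exp (-r * |x|) = 2 / r := by
  rw [integral_comp_abs (f := fun x => Real.exp (-r * x)), integral_exp_mul_Ioi (by linarith),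
    mul_zero, Real.exp_zero, neg_div_neg_eq, mul_one_div]

theorem integrable_exp_neg_mul_abs {r : ℝ} (hr : 0 < r) :
    Integrable fun x : ℝ => Real.exp (-r * |x|) :=
  not_imp_comm.1 integral_undef (by rw [integral_exp_neg_mul_abs hr]; positivity)

theorem memLp_two_exp_neg_mul_abs_sub {r : ℝ} (hr : 0 < r) (y : ℝ) :
    MemLp (fun s : ℝ => Real.exp (-r * |y - s|)) 2 := by
  rw [memLp_two_iff_integrable_sq (by fun_prop)]
  refine ((integrable_exp_neg_mul_abs (r := 2 * r) (by positivity)).comp_sub_left y).congr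
    (Eventually.of_forall fun s => ?_)
  simp only [← Real.exp_nat_mul, Nat.cast_ofNat]
  ring_nf

/-- `K` is a measurable kernel on the line dominated by `M e^{-r|y - s|}`. -/
structure IsExpKernel (K : ℝ → ℝ → ℝ) (M r : ℝ) : Prop where
  measurable : Measurable (Function.uncurry K)
  rate_pos : 0 < r
  abs_le : ∀ y s, |K y s| ≤ M * Real.exp (-r * |y - s|)

namespace IsExpKernel

variable {K : ℝ → ℝ → ℝ} {M r : ℝ} {f : ℝ → ℂ}

theorem const_nonneg (h : IsExpKernel K M r) : 0 ≤ M := by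
  simpa using (abs_nonneg _).trans (h.abs_le 0 0)

theorem swap (h : IsExpKernel K M r) : IsExpKernel (fun s y => K y s) M r :=
  ⟨h.measurable.comp measurable_swap, h.rate_pos, fun y s => by
    simpa only [abs_sub_comm] using h.abs_le s y⟩

theorem lintegral_enorm_le (h : IsExpKernel K M r) (y : ℝ) :
    ∫⁻ s, ‖K y s‖ₑ ≤ ENNReal.ofReal (M * (2 / r)) := by
  have hi := ((integrable_exp_neg_mul_abs h.rate_pos).comp_sub_left y).const_mul M
  calc ∫⁻ s, ‖K y s‖ₑ ≤ ∫⁻ s, ENNReal.ofReal (M * Real.exp (-r * |y - s|)) :=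
        lintegral_mono fun s => by
          rw [Real.enorm_eq_ofReal_abs]
          exact ENNReal.ofReal_le_ofReal (h.abs_le y s)
    _ = ENNReal.ofReal (M * (2 / r)) := by
        rw [← ofReal_integral_eq_lintegral_ofReal hi (Eventually.of_forall fun s =>
            mul_nonneg h.const_nonneg (Real.exp_pos _).le), integral_const_mul,
          integral_sub_left_eq_self (fun x => Real.exp (-r * |x|)) volume y,
          integral_exp_neg_mul_abs h.rate_pos]

theorem integrable_smul (h : IsExpKernel K M r) (hf : MemLp f 2) (y : ℝ) :
    Integrable fun s => K y s • f s := by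
  refine (((memLp_two_exp_neg_mul_abs_sub h.rate_pos y).const_mul M).integrable_mul
    hf.norm).mono' ((h.measurable.comp measurable_prodMk_left).aestronglyMeasurable.smul hf.1)
    (Eventually.of_forall fun s => ?_)
  rw [norm_smul]
  exact mul_le_mul_of_nonneg_right (h.abs_le y s) (norm_nonneg _)

theorem eLpNorm_integral_le (h : IsExpKernel K M r) (hf : AEStronglyMeasurable f) :
    eLpNorm (fun y => ∫ s, K y s • f s) 2 ≤
      ENNReal.ofReal (M * (2 / r)) * eLpNorm f 2 := by
  rw [← ENNReal.pow_le_pow_left_iff two_ne_zero, mul_pow, eLpNorm_two_sq, eLpNorm_two_sq, sq]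
  refine (lintegral_mono fun y => ENNReal.pow_le_pow_left ?_).trans
    (lintegral_sq_lintegral_mul_le_of_schur (k := fun y s => ‖K y s‖ₑ) h.measurable.enorm hf.enorm
      h.lintegral_enorm_le h.swap.lintegral_enorm_le)
  refine (enorm_integral_le_lintegral_enorm _).trans_eq ?_
  simp only [enorm_smul]

theorem memLp_integral (h : IsExpKernel K M r) (hf : MemLp f 2) :
    MemLp (fun y => ∫ s, K y s • f s) 2 :=
  ⟨AEStronglyMeasurable.integral_prod_right' (f := fun p : ℝ × ℝ => K p.1 p.2 • f p.2)
    (h.measurable.aestronglyMeasurable.smul hf.1.comp_snd),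
    (h.eLpNorm_integral_le hf.1).trans_lt (ENNReal.mul_lt_top ENNReal.ofReal_lt_top hf.2)⟩

/-- The bounded operator `f ↦ ∫ K(·,s) f(s) ds` on `L²(ℝ)`. -/
def integralOp (h : IsExpKernel K M r) : L2 →L[ℂ] L2 :=
  LinearMap.mkContinuous
    { toFun := fun f => (h.memLp_integral (Lp.memLp f)).toLp
      map_add' := fun f g => by
        rw [← MemLp.toLp_add]
        refine MemLp.toLp_congr _ _ (Eventually.of_forall fun y => ?_)
        simp only [Pi.add_apply]
        rw [← integral_add (h.integrable_smul (Lp.memLp f) y) (h.integrable_smul (Lp.memLp g) y)]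
        refine integral_congr_ae ((Lp.coeFn_add f g).mono fun s hs => ?_)
        simp only [hs, Pi.add_apply, smul_add]
      map_smul' := fun c f => by
        rw [RingHom.id_apply, ← MemLp.toLp_const_smul]
        refine MemLp.toLp_congr _ _ (Eventually.of_forall fun y => ?_)
        simp only [Pi.smul_apply]
        rw [← integral_smul]
        refine integral_congr_ae ((Lp.coeFn_smul c f).mono fun s hs => ?_)
        simp only [hs, Pi.smul_apply, smul_comm c] }
    (M * (2 / r)) fun f => by
      have hA : 0 ≤ M * (2 / r) := mul_nonneg h.const_nonneg (div_nonneg zero_le_two h.rate_pos.le)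
      have hle := ENNReal.toReal_mono (ENNReal.mul_ne_top ENNReal.ofReal_ne_top
        (Lp.eLpNorm_ne_top f)) (h.eLpNorm_integral_le (Lp.aestronglyMeasurable f))
      rwa [ENNReal.toReal_mul, ENNReal.toReal_ofReal hA, ← Lp.norm_def, ← Lp.norm_toLp _
        (h.memLp_integral (Lp.memLp f))] at hle

theorem coeFn_integralOp (h : IsExpKernel K M r) (f : L2) :
    h.integralOp f =ᵐ[volume] fun y => ∫ s, K y s • f s :=
  MemLp.coeFn_toLp (h.memLp_integral (Lp.memLp f))

end IsExpKernel

/-! ### The Green operator of the Dirichlet problem on both half lines -/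

theorem abs_sub_eq_abs_abs_sub_abs {y s : ℝ} (h : 0 < y * s) : |y - s| = |(|y| - |s|)| := by
  rcases mul_pos_iff.1 h with ⟨hy, hs⟩ | ⟨hy, hs⟩
  · rw [abs_of_pos hy, abs_of_pos hs]
  · rw [abs_of_neg hy, abs_of_neg hs, neg_sub_neg, abs_sub_comm]

namespace HalfLineBasis

variable {q : ℝ → ℝ} (B : HalfLineBasis q)

/-- The Green kernel of the two Dirichlet problems on the half lines is `B.kern B.ψ B.θ`, its
derivative in the first variable is `B.kern B.dψ B.dθ`. -/
def kern (a b : ℝ → ℝ) (y s : ℝ) : ℝ :=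
  if 0 < y * s then (if |s| ≤ |y| then a |y| * B.θ |s| else b |y| * B.ψ |s|) else 0

variable {B} {a b : ℝ → ℝ} {f : ℝ → ℂ}

theorem isExpKernel_kern (ha : Continuous a) (hb : Continuous b)
    (ha' : ∀ y, 0 ≤ y → |a y| ≤ B.bound * Real.exp (-B.rate * y))
    (hb' : ∀ y, 0 ≤ y → |b y| ≤ B.bound * Real.exp (B.rate * y)) :
    IsExpKernel (B.kern a b) (B.bound ^ 2) B.rate where
  measurable := by
    have := B.decaying.continuous
    have := B.growing.continuous
    refine Measurable.ite (measurableSet_lt (by fun_prop) (by fun_prop)) ?_ measurable_const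
    exact Measurable.ite (measurableSet_le (by fun_prop) (by fun_prop))
      (Continuous.measurable (by fun_prop)) (Continuous.measurable (by fun_prop))
  rate_pos := B.rate_pos
  abs_le y s := by
    have hM := B.bound_nonneg
    have bound_mul (x x' : ℝ) : B.bound * Real.exp x * (B.bound * Real.exp x') =
        B.bound ^ 2 * Real.exp (x + x') := by rw [Real.exp_add]; ring
    unfold kern
    split_ifs with hys hsy
    · rw [abs_sub_eq_abs_abs_sub_abs hys, abs_of_nonneg (sub_nonneg.2 hsy), abs_mul]
      refine (mul_le_mul (ha' _ (abs_nonneg y)) (B.growing.abs_le _ (abs_nonneg s))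
        (abs_nonneg _) (by positivity)).trans_eq ?_
      rw [bound_mul]
      ring_nf
    · rw [abs_sub_eq_abs_abs_sub_abs hys, abs_of_neg (sub_neg.2 (not_le.1 hsy)), abs_mul]
      refine (mul_le_mul (hb' _ (abs_nonneg y)) (B.decaying.abs_le _ (abs_nonneg s))
        (abs_nonneg _) (by positivity)).trans_eq ?_
      rw [bound_mul]
      ring_nf
    · rw [abs_zero]
      positivity

variable (B) in
theorem isExpKernel_green : IsExpKernel (B.kern B.ψ B.θ) (B.bound ^ 2) B.rate :=
  isExpKernel_kern B.decaying.continuous B.growing.continuous B.decaying.abs_le B.growing.abs_le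

variable (B) in
theorem isExpKernel_green_deriv : IsExpKernel (B.kern B.dψ B.dθ) (B.bound ^ 2) B.rate :=
  isExpKernel_kern B.decaying.continuous_deriv B.growing.continuous_deriv B.decaying.abs_deriv_le
    B.growing.abs_deriv_le

variable (B) in
/-- The solution operator of the Dirichlet problems for `-u'' + q(|·|) u = f` on the two half
lines. -/
def dirichlet : L2 →L[ℂ] L2 :=
  B.isExpKernel_green.integralOp

variable (B a b) in
/-- The variation of constants formula on the half line. -/
def variation (f : ℝ → ℂ) (y : ℝ) : ℂ :=
  a y • (∫ s in (0 : ℝ)..y, B.θ s • f s) + b y • ∫ s in Ioi y, B.ψ s • f s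

theorem integral_kern_eq_variation {y : ℝ} (hi : Integrable fun s => B.kern a b y s • f s)
    (hy : 0 < y) : ∫ s, B.kern a b y s • f s = B.variation a b f y := by
  have hsupp : ∫ s, B.kern a b y s • f s = ∫ s in Ioi 0, B.kern a b y s • f s := by
    refine (setIntegral_eq_integral_of_forall_compl_eq_zero fun s hs => ?_).symm
    rw [kern, if_neg (not_lt.2 (mul_nonpos_of_nonneg_of_nonpos hy.le (not_lt.1 hs))), zero_smul]
  rw [hsupp, ← Ioc_union_Ioi_eq_Ioi hy.le, setIntegral_union (Ioc_disjoint_Ioi le_rfl)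
    measurableSet_Ioi hi.integrableOn hi.integrableOn, variation,
    intervalIntegral.integral_of_le hy.le, ← integral_smul, ← integral_smul]
  congr 1
  · refine setIntegral_congr_fun measurableSet_Ioc fun s hs => ?_
    simp only [kern, if_pos (mul_pos hy hs.1), abs_of_pos hs.1, abs_of_pos hy, if_pos hs.2,
      mul_smul]
  · refine setIntegral_congr_fun measurableSet_Ioi fun s (hs : y < s) => ?_
    simp only [kern, if_pos (mul_pos hy (hy.trans hs)), abs_of_pos (hy.trans hs), abs_of_pos hy,
      if_neg (not_le.2 hs), mul_smul]

theorem integral_kern_neg (f : ℝ → ℂ) (y : ℝ) :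
    ∫ s, B.kern a b (-y) s • f s = ∫ s, B.kern a b y s • f (-s) := by
  rw [← integral_neg_eq_self]
  simp [kern]

theorem integrableOn_ψ_smul (hf : MemLp f 2) : IntegrableOn (fun s => B.ψ s • f s) (Ioi 0) :=
  B.isHalfLineSolution_ψ.memLp.integrable_mul (hf.restrict (Ioi 0))

theorem intervalIntegrable_smul_of_memLp {g : ℝ → ℝ} (hg : Continuous g) (hf : MemLp f 2)
    (x y : ℝ) : IntervalIntegrable (fun s => g s • f s) volume x y := by
  have hloc : LocallyIntegrable f volume := hf.locallyIntegrable (by norm_num)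
  exact (hloc.integrableOn_isCompact isCompact_uIcc).intervalIntegrable.continuousOn_smul
    hg.continuousOn

theorem isPrimitiveOn_integral_Ioi_ψ_smul (hf : MemLp f 2) :
    IsPrimitiveOn (fun y => ∫ s in Ioi y, B.ψ s • f s) (fun y => -(B.ψ y • f y)) (Ici 0) := by
  have hi := integrableOn_ψ_smul (B := B) hf
  have hprim := isPrimitiveOn_integral (fun x y =>
    (intervalIntegrable_smul_of_memLp B.decaying.continuous hf x y).neg) (Ici 0)
    (∫ s in Ioi 0, B.ψ s • f s) 0
  refine hprim.congr fun y hy => ?_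
  rw [← intervalIntegral.integral_interval_add_Ioi hi (hi.mono_set (Ioi_subset_Ioi hy)),
    add_right_comm]
  simp only [Pi.neg_apply, intervalIntegral.integral_neg, add_neg_cancel, zero_add]

theorem isHalfLineSolution_variation (hf : MemLp f 2) :
    IsHalfLineSolution q (B.variation B.ψ B.θ f) (B.variation B.dψ B.dθ f) f := by
  have hP : IsPrimitiveOn (fun y => ∫ s in (0 : ℝ)..y, B.θ s • f s) (fun y => B.θ y • f y)
      (Ici 0) := by
    simpa using isPrimitiveOn_integral
      (intervalIntegrable_smul_of_memLp B.growing.continuous hf) (Ici 0) 0 0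
  have hQ := isPrimitiveOn_integral_Ioi_ψ_smul (B := B) hf
  have memLp_variation {a b : ℝ → ℝ} (h : IsExpKernel (B.kern a b) (B.bound ^ 2) B.rate) :
      MemLp (B.variation a b f) 2 (volume.restrict (Ioi 0)) := by
    refine ((h.memLp_integral hf).restrict (Ioi 0)).ae_eq ?_
    filter_upwards [ae_restrict_mem measurableSet_Ioi] with y hy
    exact integral_kern_eq_variation (h.integrable_smul hf y) hy
  refine ⟨memLp_variation B.isExpKernel_green, memLp_variation B.isExpKernel_green_deriv, ?_, ?_⟩
  · refine ((B.decaying.prim.smul ordConnected_Ici hP).add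
      (B.growing.prim.smul ordConnected_Ici hQ)).congr_deriv ordConnected_Ici
      (Eventually.of_forall fun y _ => ?_)
    simp only [variation]
    module
  · refine ((B.decaying.prim_deriv.smul ordConnected_Ici hP).add
      (B.growing.prim_deriv.smul ordConnected_Ici hQ)).congr_deriv ordConnected_Ici
      (Eventually.of_forall fun y hy => ?_)
    simp only [variation]
    linear_combination (norm := module) (-1 : ℝ) • congrArg (· • f y) (B.wronskian hy)

theorem variation_zero (b : ℝ → ℝ) (hb : b 0 = 0) (f : ℝ → ℂ) : B.variation a b f 0 = 0 := by
  simp [variation, hb]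

theorem variation_deriv_zero (f : ℝ → ℂ) :
    B.variation B.dψ B.dθ f 0 = ∫ s in Ioi 0, B.ψ s • f s := by
  simp [variation, B.dθ_zero]

end HalfLineBasis

/-! ### Traces at the origin and gluing of half-line primitives -/

theorem tendsto_neg_ae : Tendsto (fun y : ℝ => -y) (ae volume) (ae volume) :=
  (Measure.measurePreserving_neg (volume : Measure ℝ)).quasiMeasurePreserving.tendsto_ae

theorem ae_of_ae_pos_of_ae_neg {P : ℝ → Prop} (hpos : ∀ᵐ y, 0 < y → P y)
    (hneg : ∀ᵐ y, 0 < y → P (-y)) : ∀ᵐ y, P y := by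
  filter_upwards [hpos, tendsto_neg_ae.eventually hneg, volume.ae_ne (0 : ℝ)] with y h₁ h₂ h₃
  rcases lt_or_gt_of_ne h₃ with hy | hy
  · simpa using h₂ (neg_pos.2 hy)
  · exact h₁ hy

theorem integral_eq_setIntegral_Ioi_add {E : Type*} [NormedAddCommGroup E] [NormedSpace ℝ E]
    {g : ℝ → E} (hg : Integrable g) :
    ∫ y, g y = (∫ y in Ioi 0, g y) + ∫ y in Ioi 0, g (-y) := by
  rw [← integral_add_compl measurableSet_Ioi hg, compl_Ioi, integral_comp_neg_Ioi, neg_zero]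

theorem neBot_nhdsWithin_inf_ae {s : Set ℝ} (hs : IsOpen s) {x : ℝ} (hx : x ∈ closure s) :
    (𝓝[s] x ⊓ ae volume).NeBot := by
  rw [inf_neBot_iff_frequently_left]
  intro P hP
  obtain ⟨o, ho, hxo, hsub⟩ := mem_nhdsWithin.1 hP
  have hpos : volume (o ∩ s) ≠ 0 :=
    (ho.inter hs).measure_ne_zero volume (mem_closure_iff.1 hx o ho hxo)
  exact (frequently_ae_mem_iff.2 hpos).mono hsub

theorem HasTrace.mono {l l' : Filter ℝ} {u : ℝ → ℂ} {a : ℂ} (h : HasTrace l u a) (hl : l' ≤ l) :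
    HasTrace l' u a :=
  Tendsto.mono_left h (inf_le_inf_right _ hl)

theorem HasTrace.unique {s : Set ℝ} (hs : IsOpen s) {x : ℝ} (hx : x ∈ closure s) {u : ℝ → ℂ}
    {a a' : ℂ} (h : HasTrace (𝓝[s] x) u a) (h' : HasTrace (𝓝[s] x) u a') : a = a' :=
  have := neBot_nhdsWithin_inf_ae hs hx
  tendsto_nhds_unique h h'

theorem HasTrace.of_comp_neg {u : ℝ → ℂ} {a : ℂ} (h : HasTrace (𝓝[>] 0) (fun y => u (-y)) a) :
    HasTrace (𝓝[<] 0) u a := by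
  have hneg : Tendsto (fun y : ℝ => -y) (𝓝[<] 0) (𝓝[>] 0) := by
    simpa using tendsto_neg_nhdsLT (a := (0 : ℝ))
  simpa [HasTrace, Function.comp_def] using Tendsto.comp h (hneg.inf tendsto_neg_ae)

theorem IsPrimitiveOn.hasTrace {u v U : ℝ → ℂ} (h : IsPrimitiveOn U v (Ici 0))
    (hu : ∀ᵐ y, 0 < y → u y = U y) : HasTrace (𝓝[>] 0) u (U 0) := by
  have hlim : Tendsto U (𝓝[>] 0) (𝓝 (U 0)) :=
    (h.continuousOn_Ici 0 self_mem_Ici).mono_left (nhdsWithin_mono _ Ioi_subset_Ici_self)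
  refine (hlim.mono_left inf_le_left).congr' ?_
  filter_upwards [hu.filter_mono inf_le_right,
    (eventually_mem_nhdsWithin : ∀ᶠ y in 𝓝[>] (0 : ℝ), y ∈ Ioi 0).filter_mono inf_le_left]
    with y hy hpos
  exact (hy hpos).symm

/-- Away from the origin `u` is locally absolutely continuous with derivative `v`; its continuous
representatives on `[0,∞)` and on `(-∞,0]`, the latter reflected, are `U` and `U₁`. -/
structure HasHalfLinePrimitives (u v U U₁ : ℝ → ℂ) : Prop where
  prim : IsPrimitiveOn U v (Ici 0)
  prim_neg : IsPrimitiveOn U₁ (fun y => -v (-y)) (Ici 0)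
  ae_eq : ∀ᵐ y, 0 < y → u y = U y
  ae_eq_neg : ∀ᵐ y, 0 < y → u (-y) = U₁ y

namespace HasHalfLinePrimitives

variable {u v U U₁ : ℝ → ℂ}

theorem hasTrace_nhdsGT (h : HasHalfLinePrimitives u v U U₁) : HasTrace (𝓝[>] 0) u (U 0) :=
  h.prim.hasTrace h.ae_eq

theorem hasTrace_nhdsLT (h : HasHalfLinePrimitives u v U U₁) : HasTrace (𝓝[<] 0) u (U₁ 0) :=
  (h.prim_neg.hasTrace h.ae_eq_neg).of_comp_neg

theorem eq_of_hasTrace_nhdsGT (h : HasHalfLinePrimitives u v U U₁)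
    {a : ℂ} (ha : HasTrace (𝓝[>] 0) u a) : U 0 = a :=
  h.hasTrace_nhdsGT.unique isOpen_Ioi (by simp) ha

theorem eq_of_hasTrace_nhdsLT (h : HasHalfLinePrimitives u v U U₁)
    {a : ℂ} (ha : HasTrace (𝓝[<] 0) u a) : U₁ 0 = a :=
  h.hasTrace_nhdsLT.unique isOpen_Iio (by simp) ha

theorem hasTrace_nhdsNE (h : HasHalfLinePrimitives u v U U₁)
    (h0 : U 0 = U₁ 0) : HasTrace (𝓝[≠] 0) u (U 0) := by
  have hlt : HasTrace (𝓝[<] 0) u (U 0) := h0 ▸ h.hasTrace_nhdsLT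
  rw [HasTrace, ← nhdsLT_sup_nhdsGT, inf_sup_right]
  exact hlt.sup h.hasTrace_nhdsGT

theorem integral_deriv_smul (h : HasHalfLinePrimitives u v U U₁)
    (hu : LocallyIntegrable u) (hv : LocallyIntegrable v) {η : ℝ → ℝ}
    (hη : ContDiff ℝ ∞ η) (hc : HasCompactSupport η) :
    ∫ y, deriv η y • u y = η 0 • (U₁ 0 - U 0) - ∫ y, η y • v y := by
  have hη' : Continuous (deriv η) := hη.continuous_deriv (by simp)
  have parts := h.prim.setIntegral_Ioi_deriv_smul (hη.of_le (by simp)) hc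
  have parts_neg := h.prim_neg.setIntegral_Ioi_deriv_smul (η := fun y => η (-y))
    ((hη.of_le (by simp)).comp contDiff_neg) (hc.comp_homeomorph (Homeomorph.neg ℝ))
  have congr_pos : ∫ y in Ioi 0, deriv η y • u y = ∫ y in Ioi 0, deriv η y • U y :=
    setIntegral_congr_ae measurableSet_Ioi (h.ae_eq.mono fun y hy h0 => by rw [hy h0])
  have congr_neg : ∫ y in Ioi 0, deriv η (-y) • u (-y) = ∫ y in Ioi 0, deriv η (-y) • U₁ y :=
    setIntegral_congr_ae measurableSet_Ioi (h.ae_eq_neg.mono fun y hy h0 => by rw [hy h0])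
  rw [integral_eq_setIntegral_Ioi_add (hu.integrable_smul_left_of_hasCompactSupport hη' hc.deriv),
    integral_eq_setIntegral_Ioi_add
      (hv.integrable_smul_left_of_hasCompactSupport hη.continuous hc), congr_pos, congr_neg, parts]
  simp only [deriv_comp_neg, neg_smul, integral_neg, neg_zero, smul_neg] at parts_neg
  rw [smul_sub]
  linear_combination -parts_neg

theorem isWeakDeriv_compl_zero (h : HasHalfLinePrimitives u v U U₁)
    (hu : LocallyIntegrable u) (hv : LocallyIntegrable v) :
    IsWeakDeriv {0}ᶜ u v := by
  intro η hη hc hsub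
  have hη0 : η 0 = 0 := image_eq_zero_of_notMem_tsupport fun h0 => hsub h0 rfl
  rw [h.integral_deriv_smul hu hv hη hc, hη0, zero_smul, zero_sub]

theorem isWeakDeriv_univ_iff (h : HasHalfLinePrimitives u v U U₁)
    (hu : LocallyIntegrable u) (hv : LocallyIntegrable v) :
    IsWeakDeriv univ u v ↔ U 0 = U₁ 0 := by
  constructor
  · intro hw
    let bump : ContDiffBump (0 : ℝ) := ⟨1, 2, one_pos, one_lt_two⟩
    have bump_zero : bump 0 = 1 := bump.one_of_mem_closedBall (by simp [bump])
    have jump := h.integral_deriv_smul hu hv bump.contDiff bump.hasCompactSupport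
    rw [hw bump bump.contDiff bump.hasCompactSupport (subset_univ _), bump_zero, one_smul] at jump
    linear_combination jump
  · intro h0 η hη hc _
    rw [h.integral_deriv_smul hu hv hη hc, h0, sub_self, smul_zero, zero_sub]

end HasHalfLinePrimitives

theorem memLp_two_comp_neg {u : ℝ → ℂ} (h : MemLp u 2) : MemLp (fun y => u (-y)) 2 :=
  h.comp_measurePreserving (Measure.measurePreserving_neg volume)

theorem IsWeakDeriv.mono {U U' : Set ℝ} {u v : ℝ → ℂ} (h : IsWeakDeriv U u v) (hU : U' ⊆ U) :
    IsWeakDeriv U' u v := fun η hη hc hsub => h η hη hc (hsub.trans hU)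

theorem IsWeakDeriv.comp_neg {U : Set ℝ} {u v : ℝ → ℂ} (h : IsWeakDeriv U u v) (hU : -U = U) :
    IsWeakDeriv U (fun y => u (-y)) (fun y => -v (-y)) := by
  intro η hη hc hsub
  have tsupport_neg : tsupport (fun x => η (-x)) = -tsupport η :=
    tsupport_comp_eq_preimage η (Homeomorph.neg ℝ)
  have hneg := h (fun x => η (-x)) (hη.comp contDiff_neg) (hc.comp_homeomorph (Homeomorph.neg ℝ))
    (by rw [tsupport_neg, ← hU]; exact neg_subset_neg.2 hsub)
  rw [← integral_neg_eq_self, ← integral_neg_eq_self (fun y => η (-y) • v y)] at hneg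
  simp only [deriv_comp_neg, neg_neg, neg_smul, integral_neg] at hneg
  simp only [smul_neg, integral_neg, neg_neg]
  exact neg_inj.1 hneg

theorem IsWeakDeriv.exists_hasHalfLinePrimitives {u v : ℝ → ℂ} (hu : MemLp u 2) (hv : MemLp v 2)
    (h : IsWeakDeriv {0}ᶜ u v) : ∃ U U₁, HasHalfLinePrimitives u v U U₁ := by
  have hsub : Ioi (0 : ℝ) ⊆ {0}ᶜ := fun y hy => ne_of_gt hy
  obtain ⟨U, prim, ae_eq⟩ := (h.mono hsub).exists_isPrimitiveOn (hu.restrict _) (hv.restrict _)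
  obtain ⟨U₁, prim_neg, ae_eq_neg⟩ :=
    ((h.comp_neg (by simp)).mono hsub).exists_isPrimitiveOn ((memLp_two_comp_neg hu).restrict _)
      ((memLp_two_comp_neg hv).neg.restrict _)
  exact ⟨U, U₁, prim, prim_neg, ae_eq, ae_eq_neg⟩

theorem locallyIntegrable_L2 (u : L2) : LocallyIntegrable (u : ℝ → ℂ) :=
  (Lp.memLp u).locallyIntegrable (by norm_num)

theorem deltaGraph_zero (q : ℝ → ℝ) : deltaGraph q 0 = regularGraph q := by
  ext ⟨u, f⟩
  constructor
  · rintro ⟨v, w, a, r, l, hu, hv, -, hr, hl, hjump, hf⟩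
    obtain ⟨V, V₁, hV⟩ := hv.exists_hasHalfLinePrimitives (Lp.memLp v) (Lp.memLp w)
    refine ⟨v, w, hu, (hV.isWeakDeriv_univ_iff (locallyIntegrable_L2 v)
      (locallyIntegrable_L2 w)).2 ?_, hf⟩
    rw [hV.eq_of_hasTrace_nhdsGT hr, hV.eq_of_hasTrace_nhdsLT hl]
    simpa [sub_eq_zero] using hjump
  · rintro ⟨v, w, hu, hv, hf⟩
    have hv' : IsWeakDeriv {0}ᶜ v w := hv.mono (subset_univ _)
    obtain ⟨U, U₁, hU⟩ :=
      (hu.mono (subset_univ {0}ᶜ)).exists_hasHalfLinePrimitives (Lp.memLp u) (Lp.memLp v)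
    obtain ⟨V, V₁, hV⟩ := hv'.exists_hasHalfLinePrimitives (Lp.memLp v) (Lp.memLp w)
    have U_zero := (hU.isWeakDeriv_univ_iff (locallyIntegrable_L2 u) (locallyIntegrable_L2 v)).1 hu
    have V_zero := (hV.isWeakDeriv_univ_iff (locallyIntegrable_L2 v) (locallyIntegrable_L2 w)).1 hv
    exact ⟨v, w, U 0, V 0, V₁ 0, hu, hv', hU.hasTrace_nhdsNE U_zero, hV.hasTrace_nhdsGT,
      hV.hasTrace_nhdsLT, by simp [V_zero], hf⟩

/-- `u` is glued from solutions of `-u'' + q u = f` on both half lines that agree at the origin,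
the jump of the derivative being `-c` times the value; `q` is meant to be even. -/
def IsGluedSolution (q : ℝ → ℝ) (c : ℝ) (u f : L2) : Prop :=
  ∃ U V U₁ V₁ : ℝ → ℂ, IsHalfLineSolution q U V f ∧ IsHalfLineSolution q U₁ V₁ (fun y => f (-y)) ∧
    (∀ᵐ y, 0 < y → u y = U y) ∧ (∀ᵐ y, 0 < y → u (-y) = U₁ y) ∧
    U 0 = U₁ 0 ∧ V 0 + V₁ 0 = -c * U 0

theorem IsPrimitiveOn.isHalfLineSolution {q : ℝ → ℝ} {u v w f U V : ℝ → ℂ}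
    (hu : MemLp u 2 (volume.restrict (Ioi 0))) (hv : MemLp v 2 (volume.restrict (Ioi 0)))
    (hU : IsPrimitiveOn U v (Ici 0)) (hV : IsPrimitiveOn V w (Ici 0))
    (huU : ∀ᵐ y, 0 < y → u y = U y) (hvV : ∀ᵐ y, 0 < y → v y = V y)
    (hf : ∀ᵐ y, 0 < y → f y = -w y + q y * u y) : IsHalfLineSolution q U V f where
  memLp := hu.ae_eq ((ae_restrict_iff' measurableSet_Ioi).2 huU)
  memLp_deriv := hv.ae_eq ((ae_restrict_iff' measurableSet_Ioi).2 hvV)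
  prim := hU.congr_deriv ordConnected_Ici <| by
    filter_upwards [hvV, volume.ae_ne (0 : ℝ)] with y hy hne hpos
    exact hy (lt_of_le_of_ne hpos hne.symm)
  prim_deriv := hV.congr_deriv ordConnected_Ici <| by
    filter_upwards [huU, hf, volume.ae_ne (0 : ℝ)] with y hy hfy hne hpos
    have hpos : 0 < y := lt_of_le_of_ne hpos hne.symm
    rw [← hy hpos, hfy hpos, Complex.real_smul]
    ring

theorem isGluedSolution_of_mem_deltaGraph {q : ℝ → ℝ} (hq : q.Even) {c : ℝ} {u f : L2}
    (h : (u, f) ∈ deltaGraph q c) : IsGluedSolution q c u f := by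
  obtain ⟨v, w, a, r, l, hu, hv, ha, hr, hl, hjump, hf⟩ := h
  obtain ⟨U, U₁, hU⟩ :=
    (hu.mono (subset_univ {0}ᶜ)).exists_hasHalfLinePrimitives (Lp.memLp u) (Lp.memLp v)
  obtain ⟨V, V₁, hV⟩ := hv.exists_hasHalfLinePrimitives (Lp.memLp v) (Lp.memLp w)
  have U_zero := (hU.isWeakDeriv_univ_iff (locallyIntegrable_L2 u) (locallyIntegrable_L2 v)).1 hu
  have U_zero' : U 0 = a :=
    hU.eq_of_hasTrace_nhdsGT (ha.mono (nhdsWithin_mono _ fun y hy => ne_of_gt hy))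
  refine ⟨U, V, U₁, fun y => -1 * V₁ y,
    hU.prim.isHalfLineSolution ((Lp.memLp u).restrict _) ((Lp.memLp v).restrict _) hV.prim
      hU.ae_eq hV.ae_eq (hf.mono fun y hy _ => hy),
    hU.prim_neg.isHalfLineSolution (w := fun y => -1 * -w (-y))
      ((memLp_two_comp_neg (Lp.memLp u)).restrict _)
      ((memLp_two_comp_neg (Lp.memLp v)).neg.restrict _) (hV.prim_neg.const_mul (-1)) hU.ae_eq_neg
      (hV.ae_eq_neg.mono fun y hy hpos => by simp [hy hpos]) ?_,
    hU.ae_eq, hU.ae_eq_neg, U_zero, ?_⟩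
  · filter_upwards [tendsto_neg_ae.eventually hf] with y hy _
    rw [hy, hq]
    ring
  · beta_reduce
    rw [hV.eq_of_hasTrace_nhdsGT hr, hV.eq_of_hasTrace_nhdsLT hl, U_zero']
    linear_combination hjump

theorem exists_L2_eq_on_half_lines {V V₁ : ℝ → ℂ} (h : MemLp V 2 (volume.restrict (Ioi 0)))
    (h₁ : MemLp V₁ 2 (volume.restrict (Ioi 0))) :
    ∃ v : L2, (∀ᵐ y, 0 < y → v y = V y) ∧ ∀ᵐ y, 0 < y → v (-y) = V₁ y := by
  have hsum := ((memLp_indicator_iff_restrict measurableSet_Ioi).2 h).add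
    (memLp_two_comp_neg ((memLp_indicator_iff_restrict measurableSet_Ioi).2 h₁))
  refine ⟨hsum.toLp, ?_, ?_⟩
  · filter_upwards [hsum.coeFn_toLp] with y hy hpos
    simp [hy, hpos, hpos.le]
  · filter_upwards [tendsto_neg_ae.eventually hsum.coeFn_toLp] with y hy hpos
    simp [hy, hpos, hpos.le]

theorem exists_L2_ae_eq_neg_add_mul {q : ℝ → ℝ} (hq : MemLp q ∞) (u f : L2) :
    ∃ w : L2, (f : ℝ → ℂ) =ᵐ[volume] fun y => -w y + q y * u y := by
  have hw : MemLp (fun y => (q y : ℂ) * u y - f y) 2 :=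
    ((Lp.memLp u).mul hq.ofReal).sub (Lp.memLp f)
  refine ⟨hw.toLp, ?_⟩
  filter_upwards [hw.coeFn_toLp] with y hy
  rw [hy]
  ring

theorem IsGluedSolution.mem_deltaGraph {q : ℝ → ℝ} (hq : q.Even) (hqb : MemLp q ∞) {c : ℝ}
    {u f : L2} (h : IsGluedSolution q c u f) : (u, f) ∈ deltaGraph q c := by
  obtain ⟨U, V, U₁, V₁, sol, sol₁, hu, hu₁, U_zero, hjump⟩ := h
  obtain ⟨v, hv, hv₁⟩ := exists_L2_eq_on_half_lines sol.memLp_deriv sol₁.memLp_deriv.neg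
  obtain ⟨w, hf⟩ := exists_L2_ae_eq_neg_add_mul hqb u f
  have pos_of_ne {y : ℝ} (hy : y ∈ Ici 0) (hne : y ≠ 0) : 0 < y := lt_of_le_of_ne hy hne.symm
  have hU : HasHalfLinePrimitives u v U U₁ := by
    refine ⟨sol.prim.congr_deriv ordConnected_Ici ?_, sol₁.prim.congr_deriv ordConnected_Ici ?_,
      hu, hu₁⟩
    · filter_upwards [hv, volume.ae_ne (0 : ℝ)] with y hy hne hmem
      exact (hy (pos_of_ne hmem hne)).symm
    · filter_upwards [hv₁, volume.ae_ne (0 : ℝ)] with y hy hne hmem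
      rw [hy (pos_of_ne hmem hne), Pi.neg_apply, neg_neg]
  have hV : HasHalfLinePrimitives v w V (fun y => -1 * V₁ y) := by
    refine ⟨sol.prim_deriv.congr_deriv ordConnected_Ici ?_,
      (sol₁.prim_deriv.const_mul (-1)).congr_deriv ordConnected_Ici ?_, hv,
      hv₁.mono fun y hy hpos => by simp [hy hpos]⟩
    · filter_upwards [hf, hu, volume.ae_ne (0 : ℝ)] with y hfy hy hne hmem
      rw [hfy, hy (pos_of_ne hmem hne), Complex.real_smul]
      ring
    · filter_upwards [tendsto_neg_ae.eventually hf, hu₁, volume.ae_ne (0 : ℝ)]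
        with y hfy hy hne hmem
      rw [hfy, hy (pos_of_ne hmem hne), hq, Complex.real_smul]
      ring
  exact ⟨v, w, U 0, V 0, -1 * V₁ 0,
    (hU.isWeakDeriv_univ_iff (locallyIntegrable_L2 u) (locallyIntegrable_L2 v)).2 U_zero,
    hV.isWeakDeriv_compl_zero (locallyIntegrable_L2 v) (locallyIntegrable_L2 w),
    hU.hasTrace_nhdsNE U_zero, hV.hasTrace_nhdsGT, hV.hasTrace_nhdsLT,
    by linear_combination hjump, hf⟩

theorem mem_deltaGraph_iff {q : ℝ → ℝ} (hq : q.Even) (hqb : MemLp q ∞) {c : ℝ} {u f : L2} :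
    (u, f) ∈ deltaGraph q c ↔ IsGluedSolution q c u f :=
  ⟨isGluedSolution_of_mem_deltaGraph hq, fun h => h.mem_deltaGraph hq hqb⟩

namespace HalfLineBasis

variable {q : ℝ → ℝ} (B : HalfLineBasis q)

theorem memLp_two_ψ_abs : MemLp (fun y => (B.ψ |y| : ℂ)) 2 := by
  refine ((memLp_two_exp_neg_mul_abs_sub B.rate_pos 0).const_mul B.bound).mono'
    (Complex.continuous_ofReal.comp (B.decaying.continuous.comp
      continuous_abs)).aestronglyMeasurable (Eventually.of_forall fun y => ?_)
  rw [Complex.norm_real, zero_sub, abs_neg]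
  exact B.decaying.abs_le _ (abs_nonneg y)

/-- The even extension of the decaying solution. -/
def mode : L2 := B.memLp_two_ψ_abs.toLp

theorem coeFn_mode : B.mode =ᵐ[volume] fun y => (B.ψ |y| : ℂ) := B.memLp_two_ψ_abs.coeFn_toLp

theorem mode_ne_zero : B.mode ≠ 0 := by
  intro h
  have hψ : (fun y => (B.ψ |y| : ℂ)) =ᵐ[volume] fun _ => 0 := by
    filter_upwards [B.coeFn_mode, Lp.coeFn_zero ℂ 2 (volume : Measure ℝ)] with y h₁ h₂
    rw [← h₁, h, h₂, Pi.zero_apply]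
  have hcont : Continuous fun y => (B.ψ |y| : ℂ) :=
    Complex.continuous_ofReal.comp (B.decaying.continuous.comp continuous_abs)
  simpa [B.ψ_zero] using congrFun ((hcont.ae_eq_iff_eq volume continuous_const).1 hψ) 0

theorem inner_mode (f : L2) : inner ℂ B.mode f =
    (∫ y in Ioi 0, B.ψ y • f y) + ∫ y in Ioi 0, B.ψ y • f (-y) := by
  have h : inner ℂ B.mode f = ∫ y, B.ψ |y| * f y := by
    rw [L2.inner_def]
    refine integral_congr_ae ?_
    filter_upwards [B.coeFn_mode] with y hy
    rw [RCLike.inner_apply, hy, Complex.conj_ofReal, mul_comm]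
  have hi : Integrable fun y => B.ψ |y| * f y := B.memLp_two_ψ_abs.integrable_mul (Lp.memLp f)
  rw [h, integral_eq_setIntegral_Ioi_add hi]
  congr 1 <;> refine setIntegral_congr_fun measurableSet_Ioi fun y (hy : 0 < y) => ?_ <;>
    simp [abs_of_pos hy]

theorem isHalfLineSolution_variation_add {f : ℝ → ℂ} (hf : MemLp f 2) (s : ℂ) :
    IsHalfLineSolution q (fun y => B.variation B.ψ B.θ f y + s * B.ψ y)
      (fun y => B.variation B.dψ B.dθ f y + s * B.dψ y) f := by
  simpa using (isHalfLineSolution_variation (B := B) hf).add (B.isHalfLineSolution_ψ.const_mul s)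

theorem eq_variation_add {u v f : ℝ → ℂ} (hf : MemLp f 2) (h : IsHalfLineSolution q u v f)
    {y : ℝ} (hy : 0 ≤ y) :
    u y = B.variation B.ψ B.θ f y + u 0 * B.ψ y ∧
      v y = B.variation B.dψ B.dθ f y + u 0 * B.dψ y :=
  B.isHalfLineSolution_unique h (B.isHalfLineSolution_variation_add hf (u 0))
    (by simp [variation_zero, B.θ_zero, B.ψ_zero]) hy

theorem coeFn_dirichlet_add_mode (f : L2) (s : ℂ) :
    (∀ᵐ y, 0 < y → (B.dirichlet f + s • B.mode : L2) y =
      B.variation B.ψ B.θ f y + s * B.ψ y) ∧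
    ∀ᵐ y, 0 < y → (B.dirichlet f + s • B.mode : L2) (-y) =
      B.variation B.ψ B.θ (fun y => f (-y)) y + s * B.ψ y := by
  have hi {g : ℝ → ℂ} (hg : MemLp g 2) (y : ℝ) := B.isExpKernel_green.integrable_smul hg y
  have hae : ∀ᵐ y, (B.dirichlet f + s • B.mode : L2) y =
      (∫ x, B.kern B.ψ B.θ y x • f x) + s * B.ψ |y| := by
    filter_upwards [Lp.coeFn_add (B.dirichlet f) (s • B.mode), Lp.coeFn_smul s B.mode,
      B.isExpKernel_green.coeFn_integralOp f, B.coeFn_mode] with y h₁ h₂ h₃ h₄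
    rw [h₁, Pi.add_apply, h₂, Pi.smul_apply, h₄, smul_eq_mul, ← h₃, dirichlet]
  constructor
  · filter_upwards [hae] with y h hy
    rw [h, integral_kern_eq_variation (hi (Lp.memLp f) y) hy, abs_of_pos hy]
  · filter_upwards [tendsto_neg_ae.eventually hae] with y h hy
    rw [h, integral_kern_neg,
      integral_kern_eq_variation (hi (memLp_two_comp_neg (Lp.memLp f)) y) hy, abs_neg,
      abs_of_pos hy]

theorem isGluedSolution_dirichlet_add_mode {c : ℝ} {f : L2} {s : ℂ}
    (hs : ((2 * B.slope + c : ℝ) : ℂ) * s = -inner ℂ B.mode f) :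
    IsGluedSolution q c (B.dirichlet f + s • B.mode) f := by
  obtain ⟨hpos, hneg⟩ := B.coeFn_dirichlet_add_mode f s
  refine ⟨_, _, _, _, B.isHalfLineSolution_variation_add (Lp.memLp f) s,
    B.isHalfLineSolution_variation_add (memLp_two_comp_neg (Lp.memLp f)) s, hpos, hneg, ?_, ?_⟩
  · simp [variation_zero, B.θ_zero]
  · rw [inner_mode, slope] at hs
    push_cast at hs
    simp only [variation_deriv_zero, variation_zero B.θ B.θ_zero, B.ψ_zero, Complex.ofReal_one]
    linear_combination hs

theorem exists_eq_dirichlet_add_mode {c : ℝ} {u f : L2} (h : IsGluedSolution q c u f) :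
    ∃ s : ℂ, u = B.dirichlet f + s • B.mode ∧
      ((2 * B.slope + c : ℝ) : ℂ) * s = -inner ℂ B.mode f := by
  obtain ⟨U, V, U₁, V₁, sol, sol₁, hu, hu₁, U_zero, hjump⟩ := h
  have hU (y : ℝ) (hy : 0 ≤ y) := B.eq_variation_add (Lp.memLp f) sol hy
  have hU₁ (y : ℝ) (hy : 0 ≤ y) := B.eq_variation_add (memLp_two_comp_neg (Lp.memLp f)) sol₁ hy
  refine ⟨U 0, ?_, ?_⟩
  · obtain ⟨hpos, hneg⟩ := B.coeFn_dirichlet_add_mode f (U 0)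
    refine Lp.ext (ae_of_ae_pos_of_ae_neg ?_ ?_)
    · filter_upwards [hu, hpos] with y h₁ h₂ hy
      rw [h₁ hy, h₂ hy, (hU y hy.le).1]
    · filter_upwards [hu₁, hneg] with y h₁ h₂ hy
      rw [h₁ hy, h₂ hy, (hU₁ y hy.le).1, U_zero]
  · have hV := (hU 0 le_rfl).2
    have hV₁ := (hU₁ 0 le_rfl).2
    rw [variation_deriv_zero] at hV hV₁
    rw [inner_mode, slope]
    push_cast
    linear_combination hjump - hV - hV₁ + U_zero * B.dψ 0

end HalfLineBasis

/-! ### Resolvents of operators with a rank one coupling -/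

/-- `L` is the operator whose graph consists of the pairs `(R f + s g, f)` with
`κ s = -⟨g, f⟩`. For `κ ≠ 0` it is the inverse of the rank one perturbation
`f ↦ R f - κ⁻¹ ⟨g, f⟩ g` of `R`. -/
def IsRankOneCoupling (L : L2 →ₗ.[ℂ] L2) (R : L2 →L[ℂ] L2) (g : L2) (κ : ℂ) : Prop :=
  ∀ u f, (u, f) ∈ L.graph ↔ ∃ s : ℂ, u = R f + s • g ∧ κ * s = -inner ℂ g f

theorem mem_resolvent_of_inverse {L : L2 →ₗ.[ℂ] L2} {μ : ℂ} (T : L2 →L[ℂ] L2)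
    (left_inv : ∀ u f, (u, f) ∈ L.graph → T (μ • u - f) = u)
    (right_inv : ∀ h, (T h, μ • T h - h) ∈ L.graph) : μ ∈ resolvent L := by
  have left_inv' (u : L.domain) : T (μ • (u : L2) - L u) = u := left_inv _ _ (L.mem_graph u)
  refine ⟨⟨fun u v huv => ?_, fun h => ?_⟩, ‖T‖, fun u => ?_⟩
  · have := congrArg T huv
    rw [left_inv', left_inv'] at this
    exact Subtype.ext this
  · obtain ⟨u, hu : (u : L2) = T h, hLu : L u = μ • T h - h⟩ := L.mem_graph_iff.1 (right_inv h)
    exact ⟨u, by simp only [hu, hLu, sub_sub_cancel]⟩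
  · conv_lhs => rw [← left_inv' u]
    exact T.le_opNorm _

theorem mem_kernel_iff {L : L2 →ₗ.[ℂ] L2} {u : L2} : u ∈ kernel L ↔ (u, (0 : L2)) ∈ L.graph := by
  rw [LinearPMap.mem_graph_iff]
  exact ⟨fun ⟨x, hx, hxu⟩ => ⟨x, hxu, hx⟩, fun ⟨x, hxu, hx⟩ => ⟨x, hx, hxu⟩⟩

namespace IsRankOneCoupling

variable {L : L2 →ₗ.[ℂ] L2} {R S : L2 →L[ℂ] L2} {g : L2} {κ μ : ℂ}

theorem mem_resolvent (hL : IsRankOneCoupling L R g κ) (hSR : S * (1 - μ • R) = 1)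
    (hRS : (1 - μ • R) * S = 1) (hκ : κ + μ * inner ℂ g (S g) ≠ 0) : μ ∈ resolvent L := by
  have S_sub (x : L2) : S (x - μ • R x) = x := by
    simpa using congrArg (fun A : L2 →L[ℂ] L2 => A x) hSR
  have sub_S (x : L2) : S x - μ • R (S x) = x := by
    simpa using congrArg (fun A : L2 →L[ℂ] L2 => A x) hRS
  set d : ℂ := inner ℂ g (S g)
  -- Solving `u - μ R u = s g - R h` for `u` turns the coupling condition for `f = μ u - h` into
  -- `(κ + μ d) s = ⟨g, h⟩ + μ ⟨g, S R h⟩`.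
  let σ : L2 →L[ℂ] ℂ := (κ + μ * d)⁻¹ • (innerSL ℂ g + μ • (innerSL ℂ g).comp (S.comp R))
  have hσ (h : L2) : (κ + μ * d) * σ h = inner ℂ g h + μ * inner ℂ g (S (R h)) := by
    simp [σ, ← mul_add, mul_inv_cancel_left₀ hκ]
  refine mem_resolvent_of_inverse (σ.smulRight (S g) - S.comp R) (fun u f hf => ?_) fun h => ?_
  · obtain ⟨s, hs, hsf⟩ := (hL u f).1 hf
    have hu : u = s • S g - S (R (μ • u - f)) := by
      rw [← map_smul, ← map_sub, ← S_sub u]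
      congr 1
      rw [S_sub, map_sub, map_smul, eq_sub_of_add_eq' hs.symm]
      abel
    have hgu : inner ℂ g u = s * d - inner ℂ g (S (R (μ • u - f))) := by
      conv_lhs => rw [hu, inner_sub_right, inner_smul_right]
    have hσs : σ (μ • u - f) = s := by
      refine mul_left_cancel₀ hκ ?_
      rw [hσ, inner_sub_right, inner_smul_right]
      linear_combination μ * hgu - hsf
    rw [sub_apply, ContinuousLinearMap.smulRight_apply, hσs]
    exact hu.symm
  · set u := (σ.smulRight (S g) - S.comp R) h with u_def
    have hu : u = σ h • S g - S (R h) := by simp [u_def]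
    refine (hL _ _).2 ⟨σ h, ?_, ?_⟩
    · have hRu : u - μ • R u = σ h • g - R h := by
        calc u - μ • R u = σ h • (S g - μ • R (S g)) - (S (R h) - μ • R (S (R h))) := by
              rw [hu, map_sub, map_smul]
              module
          _ = σ h • g - R h := by rw [sub_S, sub_S]
      rw [map_sub, map_smul]
      linear_combination (norm := module) hRu
    · rw [inner_sub_right, inner_smul_right, hu, inner_sub_right, inner_smul_right]
      linear_combination hσ h

theorem zero_mem_resolvent (hL : IsRankOneCoupling L R g κ) (hκ : κ ≠ 0) : 0 ∈ resolvent L :=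
  hL.mem_resolvent (S := 1) (by simp) (by simp) (by simpa using hκ)

theorem kernel_eq_span (hL : IsRankOneCoupling L R g 0) : kernel L = Submodule.span ℂ {g} := by
  ext u
  rw [mem_kernel_iff, hL, Submodule.mem_span_singleton]
  simp [eq_comm]

theorem eventually_mem_resolvent (hL : IsRankOneCoupling L R g 0) (hg : g ≠ 0) :
    ∀ᶠ μ in 𝓝[≠] 0, μ ∈ resolvent L := by
  have hcont : ContinuousAt (fun μ : ℂ => (1 : L2 →L[ℂ] L2) - μ • R) 0 := by fun_prop
  have heq : (1 : L2 →L[ℂ] L2) - (0 : ℂ) • R = 1 := by simp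
  have hunit : ∀ᶠ μ : ℂ in 𝓝 0, IsUnit ((1 : L2 →L[ℂ] L2) - μ • R) :=
    hcont.eventually (Units.isOpen.mem_nhds (by simp))
  have hinv : ContinuousAt (fun μ : ℂ => Ring.inverse ((1 : L2 →L[ℂ] L2) - μ • R)) 0 := by
    refine ContinuousAt.comp (g := Ring.inverse) ?_ hcont
    rw [heq]
    exact NormedRing.inverse_continuousAt 1
  have hne : ∀ᶠ μ : ℂ in 𝓝 0, inner ℂ g (Ring.inverse ((1 : L2 →L[ℂ] L2) - μ • R) g) ≠ 0 := by
    refine (continuousAt_const.inner (hinv.clm_apply continuousAt_const)).eventually_ne ?_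
    simpa [heq] using hg
  filter_upwards [nhdsWithin_le_nhds hunit, nhdsWithin_le_nhds hne, self_mem_nhdsWithin]
    with μ hu hd hμ
  exact hL.mem_resolvent (Ring.inverse_mul_cancel _ hu) (Ring.mul_inverse_cancel _ hu)
    (by simpa using ⟨hμ, hd⟩)

theorem zeroIsIsolatedSimpleEigenvalue (hL : IsRankOneCoupling L R g 0) (hg : g ≠ 0) :
    ZeroIsIsolatedSimpleEigenvalue L := by
  refine ⟨by rw [hL.kernel_eq_span, finrank_span_singleton hg], ?_⟩
  obtain ⟨ε, ε_pos, hε⟩ := Metric.mem_nhdsWithin_iff.1 (hL.eventually_mem_resolvent hg)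
  exact ⟨ε, ε_pos, fun μ hμ hμε => hε ⟨mem_ball_zero_iff.2 hμε, norm_pos_iff.1 hμ⟩⟩

end IsRankOneCoupling

namespace HalfLineBasis

variable {q : ℝ → ℝ} (B : HalfLineBasis q)

theorem isRankOneCoupling_deltaOp (hq : q.Even) (hqb : MemLp q ∞) (c : ℝ) :
    IsRankOneCoupling (deltaOp q c) B.dirichlet B.mode ((2 * B.slope + c : ℝ) : ℂ) := by
  intro u f
  rw [deltaOp_graph, mem_deltaGraph_iff hq hqb]
  refine ⟨B.exists_eq_dirichlet_add_mode, ?_⟩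
  rintro ⟨s, rfl, hs⟩
  exact B.isGluedSolution_dirichlet_add_mode hs

theorem isRankOneCoupling_deltaOp_zero (hq : q.Even) (hqb : MemLp q ∞) {c : ℝ}
    (hc : 2 * B.slope + c = 0) : IsRankOneCoupling (deltaOp q c) B.dirichlet B.mode 0 := by
  simpa [hc] using B.isRankOneCoupling_deltaOp hq hqb c

theorem zero_mem_resolvent_deltaOp (hq : q.Even) (hqb : MemLp q ∞) {c : ℝ}
    (hc : 2 * B.slope + c ≠ 0) : 0 ∈ resolvent (deltaOp q c) :=
  (B.isRankOneCoupling_deltaOp hq hqb c).zero_mem_resolvent (Complex.ofReal_ne_zero.2 hc)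

theorem zero_mem_resolvent_regularOp (hq : q.Even) (hqb : MemLp q ∞) (hs : B.slope ≠ 0) :
    0 ∈ resolvent (regularOp q) := by
  rw [regularOp, ← deltaGraph_zero]
  exact B.zero_mem_resolvent_deltaOp hq hqb (by simpa using hs)

/-! ### Decaying modes -/

theorem isDecayingMode_ψ (hqb : MemLp q ∞) : IsDecayingMode q (fun y => (B.ψ y : ℂ)) := by
  have sol := B.isHalfLineSolution_ψ
  have hqψ : MemLp (fun y => q y • (B.ψ y : ℂ)) 2 (volume.restrict (Ioi 0)) :=
    sol.memLp.smul (hqb.restrict _)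
  have hdψ : IsPrimitiveOn (fun y => (B.dψ y : ℂ)) (fun y => q y • (B.ψ y : ℂ)) (Ici 0) := by
    simpa using sol.prim_deriv
  refine ⟨sol.memLp, ⟨_, _, sol.memLp_deriv, hqψ, sol.prim.isWeakDeriv_Ioi, hdψ.isWeakDeriv_Ioi,
    Eventually.of_forall fun y _ => by simp⟩, ?_⟩
  simpa [B.ψ_zero] using sol.prim.hasTrace (Eventually.of_forall fun y _ => rfl)

theorem ae_eq_ψ_of_isDecayingMode {φ : ℝ → ℂ} (h : IsDecayingMode q φ) :
    φ =ᵐ[volume.restrict (Ioi 0)] fun y => (B.ψ y : ℂ) := by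
  obtain ⟨hφ, ⟨v, w, hv, hw, hφv, hvw, heq⟩, htrace⟩ := h
  obtain ⟨U, hU, hφU⟩ := hφv.exists_isPrimitiveOn hφ hv
  obtain ⟨V, hV, hvV⟩ := hvw.exists_isPrimitiveOn hv hw
  have sol : IsHalfLineSolution q U V 0 := hU.isHalfLineSolution hφ hv hV hφU hvV
    (heq.mono fun y hy hpos => (hy hpos).symm)
  have U_zero : U 0 = 1 := HasTrace.unique isOpen_Ioi (by simp) (hU.hasTrace hφU) htrace
  rw [EventuallyEq, ae_restrict_iff' measurableSet_Ioi]
  filter_upwards [hφU] with y hy hpos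
  rw [hy hpos, (B.isHalfLineSolution_unique sol B.isHalfLineSolution_ψ (by simp [U_zero, B.ψ_zero])
    (le_of_lt hpos)).1]

end HalfLineBasis

/-! ### Piecewise constant coefficients -/

section StepCoefficient

theorem hasDerivAt_comp_mul_left {f : ℝ → ℝ} {f' : ℝ} (k : ℝ) {x : ℝ}
    (h : HasDerivAt f f' (k * x)) : HasDerivAt (fun x => f (k * x)) (k * f') x := by
  simpa [Function.comp_def, mul_comm] using h.comp x ((hasDerivAt_id x).const_mul k)

/-- A solution of the equation `u'' = m u` with constant coefficient; `v` is the derivative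
of `u`. -/
structure IsClassicalSolution (m : ℝ) (u v : ℝ → ℝ) : Prop where
  hasDerivAt : ∀ y, HasDerivAt u (v y) y
  hasDerivAt_deriv : ∀ y, HasDerivAt v (m * u y) y

namespace IsClassicalSolution

variable {m : ℝ} {u v u₁ v₁ : ℝ → ℝ}

theorem continuous (h : IsClassicalSolution m u v) : Continuous u :=
  continuous_iff_continuousAt.2 fun y => (h.hasDerivAt y).continuousAt

theorem continuous_deriv (h : IsClassicalSolution m u v) : Continuous v :=
  continuous_iff_continuousAt.2 fun y => (h.hasDerivAt_deriv y).continuousAt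

theorem add (h : IsClassicalSolution m u v) (h₁ : IsClassicalSolution m u₁ v₁) :
    IsClassicalSolution m (fun y => u y + u₁ y) (fun y => v y + v₁ y) where
  hasDerivAt y := (h.hasDerivAt y).fun_add (h₁.hasDerivAt y)
  hasDerivAt_deriv y := ((h.hasDerivAt_deriv y).fun_add (h₁.hasDerivAt_deriv y)).congr_deriv
    (mul_add _ _ _).symm

theorem const_mul (c : ℝ) (h : IsClassicalSolution m u v) :
    IsClassicalSolution m (fun y => c * u y) (fun y => c * v y) where
  hasDerivAt y := (h.hasDerivAt y).const_mul c
  hasDerivAt_deriv y := ((h.hasDerivAt_deriv y).const_mul c).congr_deriv (mul_left_comm _ _ _)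

theorem comp_sub_const (c : ℝ) (h : IsClassicalSolution m u v) :
    IsClassicalSolution m (fun y => u (y - c)) (fun y => v (y - c)) where
  hasDerivAt y := (h.hasDerivAt _).comp_sub_const y c
  hasDerivAt_deriv y := (h.hasDerivAt_deriv _).comp_sub_const y c

theorem comp_const_sub (c : ℝ) (h : IsClassicalSolution m u v) :
    IsClassicalSolution m (fun y => u (c - y)) (fun y => -v (c - y)) where
  hasDerivAt y := (h.hasDerivAt _).comp_const_sub c y
  hasDerivAt_deriv y := ((h.hasDerivAt_deriv _).comp_const_sub c y).fun_neg.congr_deriv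
    (neg_neg _)

end IsClassicalSolution

/-- The solutions `C` and `S` of `u'' = m u` with `C(0) = S'(0) = 1` and `C'(0) = S(0) = 0`. As
`S' = C` and `C' = m S`, each is the derivative of the other up to a factor. -/
structure FundamentalPair (m : ℝ) where
  C : ℝ → ℝ
  S : ℝ → ℝ
  hasDerivAt_C : ∀ x, HasDerivAt C (m * S x) x
  hasDerivAt_S : ∀ x, HasDerivAt S (C x) x
  C_zero : C 0 = 1
  S_zero : S 0 = 0

namespace FundamentalPair

variable {m : ℝ} (P : FundamentalPair m)

theorem isClassicalSolution_C : IsClassicalSolution m P.C fun x => m * P.S x where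
  hasDerivAt := P.hasDerivAt_C
  hasDerivAt_deriv x := (P.hasDerivAt_S x).const_mul m

theorem isClassicalSolution_S : IsClassicalSolution m P.S P.C where
  hasDerivAt := P.hasDerivAt_S
  hasDerivAt_deriv := P.hasDerivAt_C

theorem sq_sub_mul_sq (x : ℝ) : P.C x ^ 2 - m * P.S x ^ 2 = 1 := by
  have hderiv (y : ℝ) : HasDerivAt (fun y => P.C y ^ 2 - m * P.S y ^ 2) 0 y :=
    (((P.hasDerivAt_C y).pow 2).sub (((P.hasDerivAt_S y).pow 2).const_mul m)).congr_deriv (by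
      push_cast
      ring)
  have hconst := is_const_of_deriv_eq_zero (fun y => (hderiv y).differentiableAt)
    (fun y => (hderiv y).deriv) x 0
  simpa [P.C_zero, P.S_zero] using hconst

/-- The fundamental pair of `u'' = k² m u`. -/
@[simps]
def rescale (k : ℝ) (hk : k ≠ 0) : FundamentalPair (k ^ 2 * m) where
  C x := P.C (k * x)
  S x := P.S (k * x) / k
  hasDerivAt_C x := (hasDerivAt_comp_mul_left k (P.hasDerivAt_C (k * x))).congr_deriv (by
    field_simp)
  hasDerivAt_S x := ((hasDerivAt_comp_mul_left k (P.hasDerivAt_S (k * x))).div_const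
    k).congr_deriv (mul_div_cancel_left₀ _ hk)
  C_zero := by rw [mul_zero, P.C_zero]
  S_zero := by rw [mul_zero, P.S_zero, zero_div]

/-- The fundamental pair `cosh (t x)`, `sinh (t x) / t` of `u'' = t² u`. -/
@[simps]
def hyperbolic (t : ℝ) (ht : t ≠ 0) : FundamentalPair (t ^ 2) where
  C x := Real.cosh (t * x)
  S x := Real.sinh (t * x) / t
  hasDerivAt_C x := (hasDerivAt_comp_mul_left t (Real.hasDerivAt_cosh (t * x))).congr_deriv (by
    field_simp)
  hasDerivAt_S x := ((hasDerivAt_comp_mul_left t (Real.hasDerivAt_sinh (t * x))).div_const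
    t).congr_deriv (mul_div_cancel_left₀ _ ht)
  C_zero := by simp
  S_zero := by simp

/-- The solution of `u'' = m u` with `u(0) = 1` and `u'(0) = t`. Run backwards from the point `b`,
it continues the decaying exponential `e^{-t(y-b)}` across a jump of the coefficient. -/
def robin (t x : ℝ) : ℝ := P.C x + t * P.S x

/-- The derivative of `robin`. -/
def robinDeriv (t x : ℝ) : ℝ := m * P.S x + t * P.C x

theorem isClassicalSolution_robin (t : ℝ) :
    IsClassicalSolution m (P.robin t) (P.robinDeriv t) :=
  P.isClassicalSolution_C.add (P.isClassicalSolution_S.const_mul t)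

theorem robin_zero (t : ℝ) : P.robin t 0 = 1 := by simp [robin, P.C_zero, P.S_zero]

theorem robinDeriv_zero (t : ℝ) : P.robinDeriv t 0 = t := by simp [robinDeriv, P.C_zero, P.S_zero]

theorem rescale_robin {k : ℝ} (hk : k ≠ 0) (t x : ℝ) :
    (P.rescale k hk).robin (k * t) x = P.robin t (k * x) := by
  simp only [robin, rescale_C, rescale_S]
  field_simp

theorem rescale_robinDeriv {k : ℝ} (hk : k ≠ 0) (t x : ℝ) :
    (P.rescale k hk).robinDeriv (k * t) x = k * P.robinDeriv t (k * x) := by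
  simp only [robinDeriv, rescale_C, rescale_S]
  field_simp

end FundamentalPair

/-- The even coefficient with the value `inner` for `|y| < b` and `outer` for `|y| ≥ b`. -/
def stepCoeff (b inner outer y : ℝ) : ℝ := if b ≤ |y| then outer else inner

theorem isPrimitiveOn_piecewise {b : ℝ} (hb : 0 ≤ b) {u₁ v₁ u₂ v₂ w : ℝ → ℝ}
    (h₁ : ∀ y, HasDerivAt u₁ (v₁ y) y) (hv₁ : Continuous v₁)
    (h₂ : ∀ y, HasDerivAt u₂ (v₂ y) y) (hv₂ : Continuous v₂) (hub : u₁ b = u₂ b)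
    (hw₁ : ∀ y, 0 ≤ y → y < b → w y = v₁ y) (hw₂ : ∀ y, b < y → w y = v₂ y) :
    IsPrimitiveOn ((Iic b).piecewise u₁ u₂) w (Ici 0) := by
  have hne : ∀ᵐ y : ℝ, y ≠ b := compl_mem_ae_iff.2 (measure_singleton b)
  have inner : IsPrimitiveOn ((Iic b).piecewise u₁ u₂) w (Icc 0 b) := by
    refine ((isPrimitiveOn_of_hasDerivAt h₁ hv₁ _).congr_deriv ordConnected_Icc ?_).congr
      fun y hy => (piecewise_eq_of_mem (Iic b) _ _ hy.2).symm
    filter_upwards [hne] with y hyb hy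
    exact (hw₁ y hy.1 (lt_of_le_of_ne hy.2 hyb)).symm
  have outer : IsPrimitiveOn ((Iic b).piecewise u₁ u₂) w (Ici b) := by
    refine ((isPrimitiveOn_of_hasDerivAt h₂ hv₂ _).congr_deriv ordConnected_Ici ?_).congr ?_
    · filter_upwards [hne] with y hyb hy
      exact (hw₂ y (lt_of_le_of_ne hy hyb.symm)).symm
    · intro y hy
      rcases (mem_Ici.1 hy).eq_or_lt with rfl | hlt
      · rw [piecewise_eq_of_mem _ _ _ self_mem_Iic, hub]
      · rw [piecewise_eq_of_notMem _ _ _ (by simpa using hlt)]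
  rw [← Icc_union_Ici_eq_Ici hb]
  exact inner.union outer (right_mem_Icc.2 hb) self_mem_Ici

theorem continuous_piecewise_Iic {b : ℝ} {u₁ u₂ : ℝ → ℝ} (h₁ : Continuous u₁)
    (h₂ : Continuous u₂) (hub : u₁ b = u₂ b) : Continuous ((Iic b).piecewise u₁ u₂) :=
  h₁.piecewise (by simpa [frontier_Iic] using hub) h₂

theorem exists_abs_le_mul_exp {b K r : ℝ} {u : ℝ → ℝ} (hu : Continuous u)
    (hK : ∀ y, b < y → |u y| ≤ K * Real.exp (r * y)) :
    ∃ M, ∀ y, 0 ≤ y → |u y| ≤ M * Real.exp (r * y) := by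
  obtain ⟨M, hM⟩ := (isCompact_Icc (a := (0 : ℝ)) (b := b)).exists_bound_of_continuousOn
    (f := fun y => u y / Real.exp (r * y))
    (by fun_prop (disch := exact fun _ _ => Real.exp_ne_zero _))
  refine ⟨max M K, fun y hy => ?_⟩
  rcases le_or_gt y b with hyb | hyb
  · refine le_trans ?_ (mul_le_mul_of_nonneg_right (le_max_left M K) (Real.exp_pos _).le)
    rw [← div_le_iff₀ (Real.exp_pos _)]
    simpa [abs_div] using hM y ⟨hy, hyb⟩
  · exact (hK y hyb).trans (mul_le_mul_of_nonneg_right (le_max_right M K) (Real.exp_pos _).le)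

theorem IsExpBoundedSolution.mono_bound {q u v : ℝ → ℝ} {M M' r : ℝ}
    (h : IsExpBoundedSolution q u v M r) (hM : M ≤ M') : IsExpBoundedSolution q u v M' r :=
  { h with
    abs_le := fun y hy => (h.abs_le y hy).trans (by gcongr)
    abs_deriv_le := fun y hy => (h.abs_deriv_le y hy).trans (by gcongr) }

theorem exists_isExpBoundedSolution_piecewise {b inner outer K r : ℝ} (hb : 0 ≤ b)
    {u₁ v₁ u₂ v₂ : ℝ → ℝ} (h₁ : IsClassicalSolution inner u₁ v₁)
    (h₂ : IsClassicalSolution outer u₂ v₂) (hu : u₁ b = u₂ b) (hv : v₁ b = v₂ b)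
    (hKu : ∀ y, b < y → |u₂ y| ≤ K * Real.exp (r * y))
    (hKv : ∀ y, b < y → |v₂ y| ≤ K * Real.exp (r * y)) :
    ∃ M, IsExpBoundedSolution (stepCoeff b inner outer) ((Iic b).piecewise u₁ u₂)
      ((Iic b).piecewise v₁ v₂) M r := by
  have hcu := continuous_piecewise_Iic h₁.continuous h₂.continuous hu
  have hcv := continuous_piecewise_Iic h₁.continuous_deriv h₂.continuous_deriv hv
  have left {f g : ℝ → ℝ} {y : ℝ} (hy : y < b) : (Iic b).piecewise f g y = f y :=
    piecewise_eq_of_mem _ _ _ hy.le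
  have right {f g : ℝ → ℝ} {y : ℝ} (hy : b < y) : (Iic b).piecewise f g y = g y :=
    piecewise_eq_of_notMem _ _ _ (notMem_Iic.2 hy)
  obtain ⟨M₁, hM₁⟩ := exists_abs_le_mul_exp hcu fun y hy => by rw [right hy]; exact hKu y hy
  obtain ⟨M₂, hM₂⟩ := exists_abs_le_mul_exp hcv fun y hy => by rw [right hy]; exact hKv y hy
  refine ⟨max M₁ M₂, hcu, hcv, ?_, ?_, fun y hy => (hM₁ y hy).trans ?_,
    fun y hy => (hM₂ y hy).trans ?_⟩
  · exact isPrimitiveOn_piecewise hb h₁.hasDerivAt h₁.continuous_deriv h₂.hasDerivAt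
      h₂.continuous_deriv hu (fun y _ hy => left hy) fun y hy => right hy
  · refine isPrimitiveOn_piecewise hb h₁.hasDerivAt_deriv (h₁.continuous.const_mul inner)
      h₂.hasDerivAt_deriv (h₂.continuous.const_mul outer) hv (fun y h0 hy => ?_) fun y hy => ?_
    · rw [left hy, stepCoeff, abs_of_nonneg h0, if_neg hy.not_ge, smul_eq_mul]
    · rw [right hy, stepCoeff, abs_of_pos (hb.trans_lt hy), if_pos hy.le, smul_eq_mul]
  · gcongr
    exact le_max_left _ _
  · gcongr
    exact le_max_right _ _

theorem abs_cosh_combination_le_exp {p q x : ℝ} (hx : 0 ≤ x) :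
    |p * Real.cosh x + q * Real.sinh x| ≤ (|p| + |q|) * Real.exp x := by
  have hs : 0 ≤ Real.sinh x := Real.sinh_nonneg_iff.2 hx
  have hc : 0 < Real.cosh x := Real.cosh_pos x
  rw [← Real.cosh_add_sinh, add_mul]
  refine (abs_add_le _ _).trans (add_le_add ?_ ?_)
  · rw [abs_mul, abs_of_pos hc]
    gcongr
    linarith
  · rw [abs_mul, abs_of_nonneg hs]
    gcongr
    linarith

theorem isClassicalSolution_exp (t : ℝ) :
    IsClassicalSolution (t ^ 2) (fun y => Real.exp (t * y)) (fun y => t * Real.exp (t * y)) where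
  hasDerivAt y := hasDerivAt_comp_mul_left t (Real.hasDerivAt_exp (t * y))
  hasDerivAt_deriv y := ((hasDerivAt_comp_mul_left t (Real.hasDerivAt_exp (t * y))).const_mul
    t).congr_deriv (by ring)

namespace FundamentalPair

variable {m b t : ℝ} (P : FundamentalPair m)

/-- The decaying solution of `-u'' + q u = 0` with `u(0) = 1` for the coefficient `q` that jumps
from `m` to `t²` at `b`. -/
def decaying (b t : ℝ) : ℝ → ℝ :=
  (Iic b).piecewise (fun y => (P.robin t b)⁻¹ * P.robin t (b - y))
    fun y => (P.robin t b)⁻¹ * Real.exp (-t * (y - b))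

/-- The derivative of `decaying`. -/
def decayingDeriv (b t : ℝ) : ℝ → ℝ :=
  (Iic b).piecewise (fun y => (P.robin t b)⁻¹ * -P.robinDeriv t (b - y))
    fun y => (P.robin t b)⁻¹ * (-t * Real.exp (-t * (y - b)))

theorem exists_isExpBoundedSolution_decaying (hb : 0 ≤ b) :
    ∃ M, IsExpBoundedSolution (stepCoeff b m (t ^ 2)) (P.decaying b t) (P.decayingDeriv b t)
      M (-t) := by
  have shift (y : ℝ) : Real.exp (-t * (y - b)) = Real.exp (t * b) * Real.exp (-t * y) := by
    rw [← Real.exp_add]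
    ring_nf
  have outer := ((isClassicalSolution_exp (-t)).comp_sub_const b).const_mul (P.robin t b)⁻¹
  rw [neg_sq] at outer
  refine exists_isExpBoundedSolution_piecewise hb
    (K := |(P.robin t b)⁻¹| * (1 + |t|) * Real.exp (t * b))
    (((P.isClassicalSolution_robin t).comp_const_sub b).const_mul _) outer ?_ ?_
    (fun y _ => ?_) fun y _ => ?_
  · simp [P.robin_zero]
  · simp [P.robinDeriv_zero]
  · rw [abs_mul, Real.abs_exp, shift, ← mul_assoc]
    gcongr
    exact le_mul_of_one_le_right (abs_nonneg _) (by linarith [abs_nonneg t])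
  · rw [abs_mul, abs_mul, Real.abs_exp, abs_neg, shift, ← mul_assoc, ← mul_assoc]
    gcongr
    linarith

theorem exists_isExpBoundedSolution_growing (P : FundamentalPair m) (hb : 0 ≤ b)
    (ht : 0 < t) :
    ∃ θ dθ M, IsExpBoundedSolution (stepCoeff b m (t ^ 2)) θ dθ M t ∧ θ 0 = 0 ∧ dθ 0 = 1 := by
  let H := hyperbolic t ht.ne'
  have outer : IsClassicalSolution (t ^ 2)
      (fun y => P.S b * Real.cosh (t * (y - b)) + P.C b / t * Real.sinh (t * (y - b)))
      (fun y => P.C b * Real.cosh (t * (y - b)) + t * P.S b * Real.sinh (t * (y - b))) := by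
    convert ((H.isClassicalSolution_C.comp_sub_const b).const_mul (P.S b)).add
      ((H.isClassicalSolution_S.comp_sub_const b).const_mul (P.C b)) using 2
    · simp only [H, hyperbolic_C, hyperbolic_S]
      field_simp
    · simp only [H, hyperbolic_C, hyperbolic_S]
      field_simp
      ring
  have bound {p q y : ℝ} (hy : b < y) {K : ℝ} (hK : |p| + |q| ≤ K) :
      |p * Real.cosh (t * (y - b)) + q * Real.sinh (t * (y - b))| ≤ K * Real.exp (t * y) := by
    have hx : 0 ≤ t * (y - b) := mul_nonneg ht.le (sub_nonneg.2 hy.le)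
    refine (abs_cosh_combination_le_exp hx).trans ?_
    gcongr
    · exact (by positivity : 0 ≤ |p| + |q|).trans hK
    · linarith
  obtain ⟨M, hM⟩ := exists_isExpBoundedSolution_piecewise hb P.isClassicalSolution_S outer
    (by simp) (by simp) (fun y hy => bound hy (le_max_left _ _))
    fun y hy => bound hy (le_max_right _ _)
  exact ⟨_, _, M, hM, by simp [hb, P.S_zero], by simp [hb, P.C_zero]⟩

theorem exists_halfLineBasis (P : FundamentalPair m) (hb : 0 ≤ b) (ht : 0 < t)
    (hP : P.robin t b ≠ 0) :
    ∃ B : HalfLineBasis (stepCoeff b m (t ^ 2)),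
      B.ψ = P.decaying b t ∧ B.slope = -(P.robinDeriv t b / P.robin t b) := by
  obtain ⟨M₁, h₁⟩ := P.exists_isExpBoundedSolution_decaying (t := t) hb
  obtain ⟨θ, dθ, M₂, h₂, hθ, hdθ⟩ := P.exists_isExpBoundedSolution_growing hb ht
  refine ⟨⟨P.decaying b t, P.decayingDeriv b t, θ, dθ, t, max M₁ M₂, ht,
    h₁.mono_bound (le_max_left _ _), h₂.mono_bound (le_max_right _ _), ?_, hθ, hdθ⟩, rfl, ?_⟩
  · simp [decaying, hb, hP]
  · simp [HalfLineBasis.slope, decayingDeriv, hb, div_eq_inv_mul]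

end FundamentalPair

end StepCoefficient

/-! ### Transversality and the dispersion relation -/

theorem HalfLineBasis.setIntegral_norm_sq_ne_zero {q : ℝ → ℝ} (B : HalfLineBasis q) {b : ℝ}
    (hb : 0 ≤ b) (hψ : B.ψ b ≠ 0) {φ : L2}
    (h : Submodule.span ℂ {B.mode} = Submodule.span ℂ {φ}) :
    ∫ y in {y : ℝ | b ≤ |y|}, ‖φ y‖ ^ 2 ≠ 0 := by
  obtain ⟨s, hs⟩ := Submodule.mem_span_singleton.1 (h ▸ Submodule.mem_span_singleton_self B.mode)
  have hφ : ∀ᵐ y, s * φ y = B.ψ |y| := by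
    filter_upwards [Lp.coeFn_smul s φ, B.coeFn_mode] with y hy hmode
    rw [← hmode, ← hs, hy, Pi.smul_apply, smul_eq_mul]
  intro h0
  have hzero := (setIntegral_eq_zero_iff_of_nonneg_ae
    (Eventually.of_forall fun y => sq_nonneg ‖φ y‖)
    ((Lp.memLp φ).integrable_norm_pow two_ne_zero).integrableOn).1 h0
  have hψ_ae : B.ψ =ᵐ[volume.restrict (Ici b)] 0 := by
    filter_upwards [ae_restrict_of_ae_restrict_of_subset
      (fun y (hy : b ≤ y) => hy.trans (le_abs_self y)) hzero, ae_restrict_of_ae hφ,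
      ae_restrict_mem measurableSet_Ici] with y hy hφy (hby : b ≤ y)
    have hφ0 : φ y = 0 := by simpa using hy
    rw [hφ0, mul_zero, abs_of_nonneg (hb.trans hby)] at hφy
    exact_mod_cast hφy.symm
  exact hψ (Measure.eqOn_of_ae_eq hψ_ae B.decaying.continuous.continuousOn continuousOn_const
    (by simp) self_mem_Ici)

theorem integral_indicator_one_mul {s : Set ℝ} (hs : MeasurableSet s) (f : ℝ → ℝ) :
    ∫ y, s.indicator 1 y * f y = ∫ y in s, f y := by
  simp only [← integral_indicator hs, ← indicator_mul_left, Pi.one_apply, one_mul]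

theorem eventually_eq_imp_of_strictAntiOn {X : Type*} [TopologicalSpace X] {P : ℕ → X → ℝ}
    {n : ℕ} {x₀ : X} (hcont : ∀ k, 1 ≤ k → ContinuousAt (P k) x₀) (hn : 1 ≤ n)
    (hanti : ∀ᶠ x in 𝓝 x₀, StrictAntiOn (fun k => P k x) (Ici 1)) :
    ∀ᶠ x in 𝓝 x₀, ∀ k, 1 ≤ k → P k x = P n x₀ → k = n := by
  have hanti₀ := hanti.self_of_nhds
  have above : ∀ᶠ x in 𝓝 x₀, P (n + 1) x < P n x₀ :=
    (hcont _ n.succ_pos).eventually_lt_const (hanti₀ hn n.succ_pos n.lt_succ_self)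
  have below : ∀ᶠ x in 𝓝 x₀, 2 ≤ n → P n x₀ < P (n - 1) x := eventually_imp_distrib_left.2
    fun h2 => (hcont _ (Nat.le_sub_one_of_lt h2)).eventually_const_lt
      (hanti₀ (Nat.le_sub_one_of_lt h2) hn (Nat.sub_one_lt_of_lt h2))
  filter_upwards [hanti, above, below] with x hx h_above h_below k hk he
  rcases lt_trichotomy k n with hlt | heq | hgt
  · have := hx.antitoneOn hk (show n - 1 ∈ Ici 1 by simp; omega) (by omega)
    linarith [h_below (by omega)]
  · exact heq
  · have := hx.antitoneOn (show n + 1 ∈ Ici 1 by simp) hk hgt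
    linarith

namespace FundamentalPair

variable {m b t : ℝ}

/-- The coupling `α / 2` for which `L_λ^k` has a kernel, where `t = √(1-λ)` and the step of width
`b` has the inner coefficient `m`. -/
def dispersion (P : FundamentalPair m) (b : ℝ) (k : ℕ) (t : ℝ) : ℝ :=
  P.robinDeriv t (k * b) / (k * P.robin t (k * b))

/-- The conditions on a step of width `b` under which the operators with this step have a regular
dispersion relation and uniformly bounded decaying modes. -/
structure IsAdmissible (P : FundamentalPair m) (b : ℝ) : Prop where
  robin_ne_zero : ∀ k : ℕ, 1 ≤ k → ∀ t, 0 < t → P.robin t (k * b) ≠ 0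
  dispersion_pos : ∀ k : ℕ, 1 ≤ k → ∀ t, 0 < t → 0 < P.dispersion b k t
  dispersion_strictAntiOn : ∀ t, 0 < t → StrictAntiOn (fun k => P.dispersion b k t) (Ici 1)
  exists_abs_robin_le : ∀ T, ∃ M, ∀ k : ℕ, 1 ≤ k → ∀ t, 0 < t → t < T → ∀ x ∈ Icc 0 (k * b),
    |P.robin t x| ≤ M * |P.robin t (k * b)|

theorem robinDeriv_mul_robin_sub (P : FundamentalPair m) (s t x : ℝ) :
    P.robinDeriv s x * P.robin t x - P.robinDeriv t x * P.robin s x = s - t := by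
  simp only [robin, robinDeriv]
  linear_combination (s - t) * P.sq_sub_mul_sq x

theorem dispersion_injOn (P : FundamentalPair m) {k : ℕ} (hk : 1 ≤ k)
    (hP : ∀ t, 0 < t → P.robin t (k * b) ≠ 0) : InjOn (P.dispersion b k) (Ioi 0) := by
  intro s hs t ht h
  have hs0 := hP s hs
  have ht0 := hP t ht
  have hk0 : (k : ℝ) ≠ 0 := by positivity
  rw [dispersion, dispersion, div_eq_div_iff (by positivity) (by positivity)] at h
  have hst := P.robinDeriv_mul_robin_sub s t (k * b)
  rw [← sub_eq_zero, ← hst]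
  exact mul_left_cancel₀ hk0 (by linear_combination h)

theorem one_le_C (P : FundamentalPair m) (hm : 0 ≤ m) (x : ℝ) : 1 ≤ P.C x := by
  have hsq (y : ℝ) : 1 ≤ P.C y ^ 2 := by nlinarith [P.sq_sub_mul_sq y, sq_nonneg (P.S y)]
  have hpos : 0 < P.C x := by
    by_contra! hneg
    obtain ⟨y, hy⟩ := mem_range_of_exists_le_of_exists_ge P.isClassicalSolution_C.continuous
      ⟨x, hneg⟩ ⟨0, by simp [P.C_zero]⟩
    linarith [hsq y, (by rw [hy]; norm_num : P.C y ^ 2 = 0)]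
  nlinarith [hsq x]

theorem le_S (P : FundamentalPair m) (hm : 0 ≤ m) {x : ℝ} (hx : 0 ≤ x) : x ≤ P.S x := by
  have hmono : Monotone fun y => P.S y - y :=
    monotone_of_hasDerivAt_nonneg (fun y => (P.hasDerivAt_S y).sub (hasDerivAt_id y))
      fun y => sub_nonneg.2 (P.one_le_C hm y)
  simpa [P.S_zero] using hmono hx

theorem robin_pos (P : FundamentalPair m) (hm : 0 ≤ m) (ht : 0 < t) {x : ℝ} (hx : 0 ≤ x) :
    0 < P.robin t x := by
  have hC := P.one_le_C hm x
  have hS := hx.trans (P.le_S hm hx)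
  unfold robin
  positivity

theorem robinDeriv_pos (P : FundamentalPair m) (hm : 0 ≤ m) (ht : 0 < t) {x : ℝ} (hx : 0 ≤ x) :
    0 < P.robinDeriv t x := by
  have hC := P.one_le_C hm x
  have hS := hx.trans (P.le_S hm hx)
  unfold robinDeriv
  positivity

theorem monotoneOn_robin (P : FundamentalPair m) (hm : 0 ≤ m) (ht : 0 < t) :
    MonotoneOn (P.robin t) (Ici 0) :=
  monotoneOn_of_hasDerivWithinAt_nonneg (convex_Ici 0)
    (P.isClassicalSolution_robin t).continuous.continuousOn
    (fun x _ => ((P.isClassicalSolution_robin t).hasDerivAt x).hasDerivWithinAt)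
    fun _ hx => (P.robinDeriv_pos hm ht (interior_subset hx)).le

theorem sub_mul_lt_robinDeriv_mul_robin (P : FundamentalPair m) (hm : 0 ≤ m) (ht : 0 < t) {x : ℝ}
    (hx : 0 ≤ x) : (m - t ^ 2) * x < P.robinDeriv t x * P.robin t x := by
  have hC := P.one_le_C hm x
  have hS := P.le_S hm hx
  have hS0 := hx.trans hS
  calc (m - t ^ 2) * x ≤ m * x := by nlinarith [sq_nonneg t]
    _ ≤ m * (P.S x * P.C x) := by
      gcongr
      exact hS.trans (le_mul_of_one_le_right hS0 hC)
    _ < m * (P.S x * P.C x) + t * (P.C x ^ 2 + m * P.S x ^ 2 + t * (P.C x * P.S x)) :=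
      lt_add_of_pos_right _ (by positivity)
    _ = P.robinDeriv t x * P.robin t x := by
      unfold robin robinDeriv
      ring

theorem strictAntiOn_robinDeriv_div (P : FundamentalPair m) (hm : 0 ≤ m) (ht : 0 < t) :
    StrictAntiOn (fun x => P.robinDeriv t x / (x * P.robin t x)) (Ioi 0) := by
  have hD {x : ℝ} (hx : 0 < x) : 0 < x * P.robin t x := mul_pos hx (P.robin_pos hm ht hx.le)
  have hsol := P.isClassicalSolution_robin t
  have hderiv (x : ℝ) (hx : 0 < x) :
      HasDerivAt (fun x => P.robinDeriv t x / (x * P.robin t x))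
        (((m - t ^ 2) * x - P.robinDeriv t x * P.robin t x) / (x * P.robin t x) ^ 2) x := by
    refine ((hsol.hasDerivAt_deriv x).div ((hasDerivAt_id x).mul (hsol.hasDerivAt x))
      (hD hx).ne').congr_deriv ?_
    congr 1
    simp only [id_eq, Pi.mul_apply, robin, robinDeriv]
    linear_combination (m - t ^ 2) * x * P.sq_sub_mul_sq x
  refine strictAntiOn_of_deriv_neg (convex_Ioi 0)
    (fun x hx => (hderiv x hx).continuousAt.continuousWithinAt) fun x hx => ?_
  rw [interior_Ioi] at hx
  rw [(hderiv x hx).deriv]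
  exact div_neg_of_neg_of_pos
    (sub_neg.2 (P.sub_mul_lt_robinDeriv_mul_robin hm ht (le_of_lt hx))) (pow_pos (hD hx) 2)

theorem isAdmissible_of_nonneg (P : FundamentalPair m) (hm : 0 ≤ m) (hb : 0 < b) :
    P.IsAdmissible b where
  robin_ne_zero k _ t ht := (P.robin_pos hm ht (by positivity)).ne'
  dispersion_pos k hk t ht := div_pos (P.robinDeriv_pos hm ht (by positivity))
    (mul_pos (by positivity) (P.robin_pos hm ht (by positivity)))
  dispersion_strictAntiOn t ht j hj k hk hjk := by
    have pos {i : ℕ} (hi : i ∈ Ici 1) : (0 : ℝ) < i := Nat.cast_pos.2 hi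
    have eq_mul (i : ℕ) : P.dispersion b i t =
        b * (P.robinDeriv t (i * b) / (i * b * P.robin t (i * b))) := by
      unfold dispersion
      field_simp
    simp only [eq_mul]
    exact mul_lt_mul_of_pos_left (P.strictAntiOn_robinDeriv_div hm ht
      (mul_pos (pos hj) hb) (mul_pos (pos hk) hb) (by gcongr)) hb
  exists_abs_robin_le T := ⟨1, fun k _ t ht _ x hx => by
    rw [one_mul, abs_of_pos (P.robin_pos hm ht hx.1), abs_of_pos (P.robin_pos hm ht
      (hx.1.trans hx.2))]
    exact P.monotoneOn_robin hm ht hx.1 (hx.1.trans hx.2) hx.2⟩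

theorem abs_C_eq_one (P : FundamentalPair m) {x : ℝ} (hx : P.S x = 0) : |P.C x| = 1 := by
  have hsq := P.sq_sub_mul_sq x
  rw [hx, zero_pow two_ne_zero, mul_zero, sub_zero, ← sq_abs] at hsq
  exact (pow_eq_one_iff_of_nonneg (abs_nonneg _) two_ne_zero).1 hsq

theorem dispersion_eq_div (P : FundamentalPair m) {k : ℕ} (hS : P.S (k * b) = 0) (t : ℝ) :
    P.dispersion b k t = t / k := by
  have hC : P.C (k * b) ≠ 0 := abs_pos.1 (by rw [P.abs_C_eq_one hS]; exact one_pos)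
  simp only [dispersion, robinDeriv, robin, hS, mul_zero, zero_add, add_zero]
  exact mul_div_mul_right _ _ hC

theorem abs_robin_le_of_neg (P : FundamentalPair m) (hm : m < 0) (ht : 0 ≤ t) (x : ℝ) :
    |P.robin t x| ≤ 1 + t / √(-m) := by
  have hsq := P.sq_sub_mul_sq x
  have hC : |P.C x| ≤ 1 := by
    rw [← sq_le_one_iff_abs_le_one]
    nlinarith [sq_nonneg (P.S x)]
  have hS : |P.S x| ≤ 1 / √(-m) := by
    rw [← Real.sqrt_one, ← Real.sqrt_div zero_le_one]
    refine Real.abs_le_sqrt ?_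
    rw [le_div_iff₀ (neg_pos.2 hm)]
    nlinarith [sq_nonneg (P.C x)]
  calc |P.robin t x| ≤ |P.C x| + t * |P.S x| := by
        simpa only [robin, abs_mul, abs_of_nonneg ht] using abs_add_le (P.C x) (t * P.S x)
    _ ≤ 1 + t * (1 / √(-m)) := by gcongr
    _ = 1 + t / √(-m) := by rw [mul_one_div]

theorem isAdmissible_of_S_eq_zero (P : FundamentalPair m) (hm : m < 0)
    (hS : ∀ k : ℕ, P.S (k * b) = 0) : P.IsAdmissible b where
  robin_ne_zero k _ t _ := abs_pos.1 (by simp [robin, hS, P.abs_C_eq_one])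
  dispersion_pos k hk t ht := by
    rw [P.dispersion_eq_div (hS k)]
    positivity
  dispersion_strictAntiOn t ht j hj k _ hjk := by
    simp only [P.dispersion_eq_div (hS _)]
    have : (0 : ℝ) < j := Nat.cast_pos.2 hj
    gcongr
  exists_abs_robin_le T := ⟨1 + T / √(-m), fun k _ t ht htT x _ => by
    have h1 : |P.robin t (k * b)| = 1 := by simp [robin, hS, P.abs_C_eq_one]
    rw [h1, mul_one]
    exact (P.abs_robin_le_of_neg hm ht.le x).trans (by gcongr)⟩

end FundamentalPair

/-! ### The hypotheses of the existence theorem -/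

theorem memLp_top_waveCoeff {V₀ W : ℝ → ℝ} (hV : MemLp V₀ ∞) (hW : MemLp W ∞) (k : ℕ)
    (lam : ℝ) : MemLp (waveCoeff V₀ W k lam) ∞ :=
  (((memLp_top_const 1).sub (hV.const_mul lam)).sub hW).const_mul _

theorem even_waveCoeff {V₀ W : ℝ → ℝ} (hV : V₀.Even) (hW : W.Even) (k : ℕ) (lam : ℝ) :
    (waveCoeff V₀ W k lam).Even := fun y => by
  rw [waveCoeff, waveCoeff, hV, hW]

theorem HalfLineBasis.eLpNorm_le_of_isDecayingMode {q G : ℝ → ℝ} (B : HalfLineBasis q)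
    (hG : ∀ y, 0 ≤ y → |B.ψ y| ≤ G y) {φ : ℝ → ℂ} (hφ : IsDecayingMode q φ) :
    eLpNorm φ 2 (volume.restrict (Ioi 0)) ≤ eLpNorm G 2 (volume.restrict (Ioi 0)) := by
  rw [eLpNorm_congr_ae (B.ae_eq_ψ_of_isDecayingMode hφ)]
  refine eLpNorm_mono_ae_real ?_
  filter_upwards [ae_restrict_mem measurableSet_Ioi] with y hy
  rw [Complex.norm_real]
  exact hG y (le_of_lt hy)

theorem existenceHypotheses_of_halfLineBasis (γ : ℝ) {α lamstar : ℝ} {kstar : ℕ} {V₀ W G : ℝ → ℝ}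
    {J : Set ℝ} (hV : MemLp V₀ ∞) (hW : MemLp W ∞) (hVe : V₀.Even) (hWe : W.Even)
    (hJ : IsOpen J) (hJc : J.OrdConnected) (hk : 1 ≤ kstar) (hlam : lamstar ∈ J)
    (B : ∀ k : ℕ, 1 ≤ k → ∀ lam ∈ J, HalfLineBasis (waveCoeff V₀ W k lam))
    (slope_ne : ∀ k hk lam hlam, (B k hk lam hlam).slope ≠ 0)
    (slope_eq_iff : ∀ k hk lam hlam,
      2 * (B k hk lam hlam).slope + k ^ 2 * α = 0 ↔ (k, lam) = (kstar, lamstar))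
    (hG : MemLp G 2 (volume.restrict (Ioi 0)))
    (abs_ψ_le : ∀ k hk lam hlam y, 0 ≤ y → |(B k hk lam hlam).ψ y| ≤ G y)
    (transversal : ∀ φ : L2,
      Submodule.span ℂ {(B kstar hk lamstar hlam).mode} = Submodule.span ℂ {φ} →
        ∫ y, V₀ y * ‖φ y‖ ^ 2 ≠ 0) :
    ExistenceHypotheses (γ • delta0)
      (fun lam => lam • regularDistribution V₀ + regularDistribution W + α • delta0)
      kstar lamstar := by
  have even := even_waveCoeff hVe hWe
  have bdd := memLp_top_waveCoeff hV hW
  have coupling := (B kstar hk lamstar hlam).isRankOneCoupling_deltaOp_zero (even _ _) (bdd _ _)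
    ((slope_eq_iff _ _ _ _).2 rfl)
  refine ⟨γ, α, V₀, W, rfl, fun _ => rfl, ⟨hV, hW, hVe, hWe⟩, J, J,
    ⟨hJc, fun k hk lam hlam => (B k hk lam hlam).zero_mem_resolvent_regularOp (even _ _) (bdd _ _)
      (slope_ne k hk lam hlam)⟩,
    ⟨hJ, hJc, Subset.rfl, hlam,
      coupling.zeroIsIsolatedSimpleEigenvalue (B kstar hk lamstar hlam).mode_ne_zero,
      fun k hk lam hlam hne => (B k hk lam hlam).zero_mem_resolvent_deltaOp (even _ _) (bdd _ _)
        fun h => hne ((slope_eq_iff k hk lam hlam).1 h)⟩,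
    ⟨(eLpNorm G 2 (volume.restrict (Ioi 0))).toReal + 1, by positivity,
      fun k hk lam hlam => ⟨⟨_, (B k hk lam hlam).isDecayingMode_ψ (bdd _ _)⟩, fun φ hφ => ?_⟩⟩,
    fun φ hφ => transversal φ (coupling.kernel_eq_span.symm.trans hφ)⟩
  refine ((B k hk lam hlam).eLpNorm_le_of_isDecayingMode (abs_ψ_le k hk lam hlam) hφ).trans ?_
  exact (ENNReal.le_ofReal_iff_toReal_le hG.2.ne (by positivity)).2 (by linarith)

/-! ### The step potential -/

/-- The part `V₀ = 1_{|y| ≥ b}` of the step potential. -/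
def outerStep (b : ℝ) : ℝ → ℝ := {y : ℝ | b ≤ |y|}.indicator 1

/-- The part `W = β 1_{|y| < b}` of the step potential. -/
def innerStep (β b : ℝ) : ℝ → ℝ := fun y => β * {y : ℝ | |y| < b}.indicator 1 y

theorem measurableSet_le_abs (b : ℝ) : MeasurableSet {y : ℝ | b ≤ |y|} :=
  measurableSet_le measurable_const measurable_id.abs

theorem memLp_top_indicator_abs_lt (b : ℝ) :
    MemLp ({y : ℝ | |y| < b}.indicator (1 : ℝ → ℝ)) ∞ :=
  (memLp_top_const (1 : ℝ)).indicator (measurableSet_lt measurable_id.abs measurable_const)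

theorem memLp_top_outerStep (b : ℝ) : MemLp (outerStep b) ∞ :=
  (memLp_top_const (1 : ℝ)).indicator (measurableSet_le_abs b)

theorem memLp_top_innerStep (β b : ℝ) : MemLp (innerStep β b) ∞ :=
  (memLp_top_indicator_abs_lt b).const_mul β

theorem even_outerStep (b : ℝ) : (outerStep b).Even := fun y => by
  simp [outerStep, indicator]

theorem even_innerStep (β b : ℝ) : (innerStep β b).Even := fun y => by
  simp [innerStep, indicator]

theorem waveCoeff_step (b β : ℝ) (k : ℕ) {lam : ℝ} (h : lam ≤ 1) :
    waveCoeff (outerStep b) (innerStep β b) k lam =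
      stepCoeff b (k ^ 2 * (1 - β)) ((k * √(1 - lam)) ^ 2) := by
  ext y
  rw [mul_pow, Real.sq_sqrt (sub_nonneg.2 h)]
  by_cases hy : b ≤ |y|
  · simp [waveCoeff, outerStep, innerStep, stepCoeff, indicator, hy]
  · simp [waveCoeff, outerStep, innerStep, stepCoeff, indicator, hy, not_le.1 hy]

theorem regularDistribution_apply {g : ℝ → ℝ} (hg : LocallyIntegrable g)
    (f : TestFunction (⊤ : TopologicalSpace.Opens ℝ) ℝ ⊤) :
    regularDistribution g f = ∫ y, f y * g y :=
  TestFunction.integralAgainstBilinCLM_eq_integral (hg.locallyIntegrableOn _)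

theorem regularDistribution_const_mul (β : ℝ) {g : ℝ → ℝ} (hg : LocallyIntegrable g) :
    regularDistribution (fun y => β * g y) = β • regularDistribution g := by
  have hβ : LocallyIntegrable fun y => β * g y := hg.smul β
  ext f
  refine (regularDistribution_apply hβ f).trans ?_
  change _ = β • regularDistribution g f
  simp_rw [regularDistribution_apply hg, smul_eq_mul, ← integral_const_mul, mul_left_comm]

theorem stepPotential_eq (β b α : ℝ) :
    stepPotential β b α = fun lam => lam • regularDistribution (outerStep b) +
      regularDistribution (innerStep β b) + α • delta0 := by
  ext1 lam
  rw [show regularDistribution (innerStep β b) = _ from regularDistribution_const_mul β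
    ((memLp_top_indicator_abs_lt b).locallyIntegrable le_top)]
  rfl

namespace FundamentalPair

variable {m b t α β lam lamstar : ℝ} {kstar : ℕ}

theorem decaying_self_ne_zero (P : FundamentalPair m) (hP : P.robin t b ≠ 0) :
    P.decaying b t b ≠ 0 := by
  simpa [decaying, P.robin_zero] using hP

theorem abs_decaying_le (P : FundamentalPair m) {r M : ℝ} (hb : 0 ≤ b) (hP : P.robin t b ≠ 0)
    (hr : 0 ≤ r) (hrt : r ≤ t) (hM : ∀ x ∈ Icc 0 b, |P.robin t x| ≤ M * |P.robin t b|) {y : ℝ}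
    (hy : 0 ≤ y) : |P.decaying b t y| ≤ M * Real.exp (r * b) * Real.exp (-r * y) := by
  have hP' : 0 < |P.robin t b| := abs_pos.2 hP
  have hratio {x : ℝ} (hx : x ∈ Icc 0 b) : |(P.robin t b)⁻¹ * P.robin t x| ≤ M := by
    rw [abs_mul, abs_inv, inv_mul_le_iff₀ hP', mul_comm]
    exact hM x hx
  have hM0 : 0 ≤ M := (abs_nonneg _).trans (hratio (left_mem_Icc.2 hb))
  have hinv : |(P.robin t b)⁻¹| ≤ M := by
    simpa only [P.robin_zero, mul_one] using hratio (left_mem_Icc.2 hb)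
  rw [mul_assoc, ← Real.exp_add, decaying]
  rcases le_or_gt y b with hyb | hyb
  · rw [piecewise_eq_of_mem (Iic b) _ _ hyb]
    refine (hratio ⟨sub_nonneg.2 hyb, sub_le_self b hy⟩).trans
      (le_mul_of_one_le_right hM0 (Real.one_le_exp ?_))
    linarith [mul_le_mul_of_nonneg_left hyb hr]
  · rw [piecewise_eq_of_notMem _ _ _ (notMem_Iic.2 hyb), abs_mul, Real.abs_exp]
    gcongr
    linarith [mul_le_mul_of_nonneg_right hrt (sub_nonneg.2 hyb.le)]

theorem exists_halfLineBasis_waveCoeff (P : FundamentalPair (1 - β)) (hb : 0 ≤ b) {k : ℕ}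
    (hk : 1 ≤ k) (hlam : lam < 1) (hP : P.robin √(1 - lam) (k * b) ≠ 0) :
    ∃ B : HalfLineBasis (waveCoeff (outerStep b) (innerStep β b) k lam),
      B.slope = -(k ^ 2 * P.dispersion b k √(1 - lam)) ∧ B.ψ b ≠ 0 ∧
      ∀ r M, 0 ≤ r → r ≤ √(1 - lam) →
        (∀ x ∈ Icc 0 (k * b), |P.robin √(1 - lam) x| ≤ M * |P.robin √(1 - lam) (k * b)|) →
        ∀ y, 0 ≤ y → |B.ψ y| ≤ M * Real.exp (r * b) * Real.exp (-r * y) := by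
  have hk1 : (1 : ℝ) ≤ k := Nat.one_le_cast.2 hk
  have hk0 : (k : ℝ) ≠ 0 := by positivity
  have ht : 0 < √(1 - lam) := Real.sqrt_pos.2 (sub_pos.2 hlam)
  have hPk : (P.rescale k hk0).robin (k * √(1 - lam)) b ≠ 0 := by rwa [rescale_robin]
  rw [waveCoeff_step b β k hlam.le]
  obtain ⟨B, hψ, hslope⟩ := (P.rescale k hk0).exists_halfLineBasis hb (by positivity) hPk
  refine ⟨B, ?_, hψ ▸ decaying_self_ne_zero _ hPk, fun r M hr hrt hM y hy => ?_⟩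
  · rw [hslope, rescale_robin, rescale_robinDeriv, dispersion]
    field_simp
  · rw [hψ]
    refine abs_decaying_le _ hb hPk hr (hrt.trans (le_mul_of_one_le_left ht.le hk1))
      (fun x hx => ?_) hy
    rw [rescale_robin, rescale_robin]
    exact hM _ ⟨mul_nonneg (by positivity) hx.1, by gcongr; exact hx.2⟩

theorem IsAdmissible.eventually_dispersion_eq_imp {P : FundamentalPair m} (hP : P.IsAdmissible b)
    (hk : 1 ≤ kstar) (hlam : lamstar < 1) :
    ∀ᶠ lam in 𝓝 lamstar, ∀ k, 1 ≤ k →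
      P.dispersion b k √(1 - lam) = P.dispersion b kstar √(1 - lamstar) →
        (k, lam) = (kstar, lamstar) := by
  have sqrt_pos {lam : ℝ} (h : lam < 1) : 0 < √(1 - lam) := Real.sqrt_pos.2 (sub_pos.2 h)
  have hcont (k : ℕ) (hk : 1 ≤ k) :
      ContinuousAt (fun lam => P.dispersion b k √(1 - lam)) lamstar := by
    have hP0 := hP.robin_ne_zero k hk _ (sqrt_pos hlam)
    have hk0 : (k : ℝ) ≠ 0 := by positivity
    unfold dispersion robinDeriv
    unfold robin at hP0 ⊢
    exact ContinuousAt.div (by fun_prop) (by fun_prop) (mul_ne_zero hk0 hP0)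
  have hanti : ∀ᶠ lam in 𝓝 lamstar,
      StrictAntiOn (fun k => P.dispersion b k √(1 - lam)) (Ici 1) := by
    filter_upwards [eventually_lt_nhds hlam] with lam h
    exact hP.dispersion_strictAntiOn _ (sqrt_pos h)
  filter_upwards [eventually_lt_nhds hlam, eventually_eq_imp_of_strictAntiOn hcont hk hanti]
    with lam h hlam_imp k hk1 he
  obtain rfl := hlam_imp k hk1 he
  have hsqrt := P.dispersion_injOn hk (hP.robin_ne_zero k hk) (sqrt_pos h) (sqrt_pos hlam) he
  have := (Real.sqrt_inj (sub_pos.2 h).le (sub_pos.2 hlam).le).1 hsqrt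
  rw [sub_right_injective this]

theorem IsAdmissible.existenceHypotheses {P : FundamentalPair (1 - β)} (hP : P.IsAdmissible b)
    (γ : ℝ) (hb : 0 ≤ b) (hk : 1 ≤ kstar) (hlam : lamstar < 1)
    (hα : α = 2 * P.dispersion b kstar √(1 - lamstar)) :
    ExistenceHypotheses (γ • delta0) (stepPotential β b α) kstar lamstar := by
  set t₀ := √(1 - lamstar)
  have ht₀ : 0 < t₀ := Real.sqrt_pos.2 (sub_pos.2 hlam)
  have hsqrt : ContinuousAt (fun lam : ℝ => √(1 - lam)) lamstar := by fun_prop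
  obtain ⟨δ, hδ, hball⟩ := Metric.eventually_nhds_iff_ball.1
    ((eventually_lt_nhds hlam).and ((hP.eventually_dispersion_eq_imp hk hlam).and
      ((hsqrt.eventually_const_lt (half_lt_self ht₀)).and
        (hsqrt.eventually_lt_const (lt_two_mul_self ht₀)))))
  obtain ⟨M, hM⟩ := hP.exists_abs_robin_le (2 * t₀)
  have sqrt_pos {lam : ℝ} (h : lam ∈ Metric.ball lamstar δ) : 0 < √(1 - lam) :=
    Real.sqrt_pos.2 (sub_pos.2 (hball lam h).1)
  choose B hslope hψ hbound using fun (k : ℕ) (hk : 1 ≤ k) lam (h : lam ∈ Metric.ball lamstar δ) =>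
    P.exists_halfLineBasis_waveCoeff hb hk (hball lam h).1 (hP.robin_ne_zero k hk _ (sqrt_pos h))
  rw [stepPotential_eq]
  refine existenceHypotheses_of_halfLineBasis γ (memLp_top_outerStep b) (memLp_top_innerStep β b)
    (even_outerStep b) (even_innerStep β b) Metric.isOpen_ball (convex_ball _ _).ordConnected hk
    (Metric.mem_ball_self hδ) B ?_ ?_
    ((memLp_two_exp_mul_Ioi (by linarith : -(t₀ / 2) < 0) 0).const_mul (M * Real.exp (t₀ / 2 * b)))
    (fun k hk lam h => ?_) fun φ hφ => ?_
  · intro k hk lam h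
    have := hP.dispersion_pos k hk _ (sqrt_pos h)
    rw [hslope]
    exact neg_ne_zero.2 (by positivity)
  · intro k hk lam h
    rw [hslope, hα]
    refine ⟨fun heq => (hball lam h).2.1 k hk ?_, ?_⟩
    · have hk0 : (k : ℝ) ^ 2 ≠ 0 := by positivity
      exact mul_left_cancel₀ hk0 (by linarith)
    · rintro ⟨⟩
      ring
  · obtain ⟨-, -, hlower, hupper⟩ := hball lam h
    exact hbound k hk lam h _ M (half_pos ht₀).le hlower.le (hM k hk _ (sqrt_pos h) hupper)
  · rw [outerStep, integral_indicator_one_mul (measurableSet_le_abs b)]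
    exact (B _ _ _ _).setIntegral_norm_sq_ne_zero hb (hψ _ _ _ _) hφ

end FundamentalPair

namespace FundamentalPair

/-- The fundamental pair `1`, `x` of `u'' = 0`. -/
@[simps]
def linear : FundamentalPair 0 where
  C _ := 1
  S x := x
  hasDerivAt_C x := by simpa using hasDerivAt_const x (1 : ℝ)
  hasDerivAt_S := hasDerivAt_id
  C_zero := rfl
  S_zero := rfl

/-- The fundamental pair `cos (σ x)`, `sin (σ x) / σ` of `u'' = -σ² u`. -/
@[simps]
def trigonometric (σ : ℝ) (hσ : σ ≠ 0) : FundamentalPair (-σ ^ 2) where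
  C x := Real.cos (σ * x)
  S x := Real.sin (σ * x) / σ
  hasDerivAt_C x := (hasDerivAt_comp_mul_left σ (Real.hasDerivAt_cos (σ * x))).congr_deriv (by
    field_simp)
  hasDerivAt_S x := ((hasDerivAt_comp_mul_left σ (Real.hasDerivAt_sin (σ * x))).div_const
    σ).congr_deriv (mul_div_cancel_left₀ _ hσ)
  C_zero := by simp
  S_zero := by simp

theorem linear_dispersion (b : ℝ) (k : ℕ) (t : ℝ) :
    linear.dispersion b k t = t / (k * (1 + t * k * b)) := by
  simp only [dispersion, robinDeriv, robin, linear_C, linear_S]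
  ring_nf

theorem hyperbolic_dispersion {σ : ℝ} (hσ : σ ≠ 0) (b : ℝ) (k : ℕ) (t : ℝ) :
    (hyperbolic σ hσ).dispersion b k t = σ / k *
      ((σ * Real.sinh (k * σ * b) + t * Real.cosh (k * σ * b)) /
        (σ * Real.cosh (k * σ * b) + t * Real.sinh (k * σ * b))) := by
  simp only [dispersion, robinDeriv, robin, hyperbolic_C, hyperbolic_S,
    show σ * (k * b) = k * σ * b by ring]
  field_simp

theorem trigonometric_S_eq_zero {σ : ℝ} (hσ : σ ≠ 0) (k : ℕ) :
    (trigonometric σ hσ).S (k * (Real.pi / σ)) = 0 := by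
  rw [trigonometric_S, mul_left_comm, mul_div_cancel₀ _ hσ, Real.sin_nat_mul_pi, zero_div]

theorem isAdmissible_trigonometric {σ : ℝ} (hσ : σ ≠ 0) :
    (trigonometric σ hσ).IsAdmissible (Real.pi / σ) :=
  isAdmissible_of_S_eq_zero _ (neg_lt_zero.2 (by positivity)) (trigonometric_S_eq_zero hσ)

theorem trigonometric_dispersion {σ : ℝ} (hσ : σ ≠ 0) (k : ℕ) (t : ℝ) :
    (trigonometric σ hσ).dispersion (Real.pi / σ) k t = t / k :=
  dispersion_eq_div _ (trigonometric_S_eq_zero hσ k) t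

variable {m b α β lamstar : ℝ} {kstar : ℕ}

theorem IsAdmissible.pos_and_existenceHypotheses {P : FundamentalPair m} (hP : P.IsAdmissible b)
    (γ : ℝ) (hm : m = 1 - β) (hb : 0 < b) (hk : 1 ≤ kstar) (hlam : lamstar < 1)
    (hα : α = 2 * P.dispersion b kstar √(1 - lamstar)) :
    0 < b ∧ 0 < α ∧ ExistenceHypotheses (γ • delta0) (stepPotential β b α) kstar lamstar := by
  subst hm
  exact ⟨hb, hα ▸ mul_pos two_pos (hP.dispersion_pos kstar hk _
    (Real.sqrt_pos.2 (sub_pos.2 hlam))), hP.existenceHypotheses γ hb.le hk hlam hα⟩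

end FundamentalPair

end TravelingWave

end

theorem corollary2p11 (γ β b α lamstar : ℝ) (kstar : ℕ) (hk : 1 ≤ kstar) (hlam : lamstar < 1)
    (hcase :
      (1 < β ∧ b = Real.pi / √(β - 1) ∧ α = 2 * √(1 - lamstar) / kstar) ∨
      (β < 1 ∧ 0 < b ∧
        α = 2 * √(1 - β) / kstar *
          ((√(1 - β) * Real.sinh (kstar * √(1 - β) * b) +
              √(1 - lamstar) * Real.cosh (kstar * √(1 - β) * b)) /
            (√(1 - β) * Real.cosh (kstar * √(1 - β) * b) +
              √(1 - lamstar) * Real.sinh (kstar * √(1 - β) * b)))) ∨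
      (β = 1 ∧ 0 < b ∧
        α = 2 * √(1 - lamstar) / (kstar * (1 + √(1 - lamstar) * kstar * b)))) :
    0 < b ∧ 0 < α ∧
      TravelingWave.ExistenceHypotheses (γ • TravelingWave.delta0)
        (TravelingWave.stepPotential β b α) kstar lamstar := by
  rcases hcase with ⟨hβ, rfl, hα⟩ | ⟨hβ, hb, hα⟩ | ⟨rfl, hb, hα⟩
  · have hσ : 0 < √(β - 1) := Real.sqrt_pos.2 (sub_pos.2 hβ)
    have hm : -√(β - 1) ^ 2 = 1 - β := by rw [Real.sq_sqrt (sub_pos.2 hβ).le, neg_sub]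
    refine (TravelingWave.FundamentalPair.isAdmissible_trigonometric
      hσ.ne').pos_and_existenceHypotheses γ hm (by positivity) hk hlam ?_
    rw [hα, TravelingWave.FundamentalPair.trigonometric_dispersion, mul_div_assoc]
  · have hσ : 0 < √(1 - β) := Real.sqrt_pos.2 (sub_pos.2 hβ)
    have hm : √(1 - β) ^ 2 = 1 - β := Real.sq_sqrt (sub_pos.2 hβ).le
    refine ((TravelingWave.FundamentalPair.hyperbolic _ hσ.ne').isAdmissible_of_nonneg
      (sq_nonneg _) hb).pos_and_existenceHypotheses γ hm hb hk hlam ?_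
    rw [hα, TravelingWave.FundamentalPair.hyperbolic_dispersion]
    ring
  · refine (TravelingWave.FundamentalPair.linear.isAdmissible_of_nonneg
      le_rfl hb).pos_and_existenceHypotheses γ (sub_self 1).symm hb hk hlam ?_
    rw [hα, TravelingWave.FundamentalPair.linear_dispersion, mul_div_assoc]
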